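/- All C*-algebras are unital and nonzero; $\mathfrak{sa}(\mathfrak A)$ is the self-adjoint part and $\mathscr S(\mathfrak A)$ the state space of $\mathfrak A$. **Spaces.** A quantum compact metric space $(\mathfrak A,\mathsf L)$ is a unital C*-algebra $\mathfrak A$ with a seminorm $\mathsf L$ on a dense subspace of $\mathfrak{sa}(\mathfrak A)$ (set $\mathsf L=\infty$ off this subspace, and $0\cdot\infty=0$) such that $\{a:\mathsf L(a)=0\}=\mathbb R1_{\mathfrak A}$ and such that the Monge–Kantorovich metric $$\mathsf{mk}_{\mathsf L}(\varphi,\psi)=\sup\{|\varphi(a)-\psi(a)|: a\in\mathfrak{sa}(\mathfrak A),\ \mathsf L(a)\le 1\}$$ induces the weak* topology on $\mathscr S(\mathfrak A)$. It is Leibniz if $\mathsf L$ is lower semicontinuous for the norm of $\mathfrak A$ and, for all $a,b\in\mathfrak{sa}(\mathfrak A)$, $$\mathsf L\left(\tfrac{ab+ba}{2}\right)\le\|a\|\mathsf L(b)+\|b\|\mathsf L(a),\qquad \mathsf L\left(\tfrac{ab-ba}{2i}\right)\le\|a\|\mathsf L(b)+\|b\|\mathsf L(a).$$ A *-isomorphism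 $\Phi:\mathfrak A\to\mathfrak B$ is an isometric isomorphism $(\mathfrak A,\mathsf L_{\mathfrak A})\to(\mathfrak B,\mathsf L_{\mathfrak B})$ if $\varphi\mapsto\varphi\circ\Phi$ is an isometry from $(\mathscr S(\mathfrak B),\mathsf{mk}_{\mathsf L_{\mathfrak B}})$ onto $(\mathscr S(\mathfrak A),\mathsf{mk}_{\mathsf L_{\mathfrak A}})$. **Bridges.** A bridge $\gamma=(\mathfrak D,\omega,\pi_{\mathfrak A},\pi_{\mathfrak B})$ from $\mathfrak A$ to $\mathfrak B$ is a unital C*-algebra $\mathfrak D$, unital injective *-homomorphisms $\pi_{\mathfrak A}:\mathfrak A\to\mathfrak D$, $\pi_{\mathfrak B}:\mathfrak B\to\mathfrak D$, and $\omega\in\mathfrak D$ such that $$\mathscr S_1(\omega)=\{\varphi\in\mathscr S(\mathfrak D):\varphi((1-\omega)^*(1-\omega))=\varphi((1-\omega)(1-\omega)^*)=0\}$$ is nonempty. Write $\mathrm{Lip}_1(\mathsf L)=\{a:\mathsf L(a)\le 1\}$. The reach of $\gamma$ is the Hausdorff distance in the norm of $\mathfrak D$ between $\pi_{\mathfrak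 A}(\mathrm{Lip}_1(\mathsf L_{\mathfrak A}))\,\omega$ and $\omega\,\pi_{\mathfrak B}(\mathrm{Lip}_1(\mathsf L_{\mathfrak B}))$. The height of $\gamma$ is the larger of the $\mathsf{mk}_{\mathsf L_{\mathfrak A}}$-Hausdorff distance between $\mathscr S(\mathfrak A)$ and $\{\varphi\circ\pi_{\mathfrak A}:\varphi\in\mathscr S_1(\omega)\}$ and the $\mathsf{mk}_{\mathsf L_{\mathfrak B}}$-Hausdorff distance between $\mathscr S(\mathfrak B)$ and $\{\varphi\circ\pi_{\mathfrak B}:\varphi\in\mathscr S_1(\omega)\}$. The length of $\gamma$ is the maximum of its reach and its height. **Propinquity.** For a nonempty class $\mathcal C$ of quantum compact metric spaces, a $\mathcal C$-trek between two members of $\mathcal C$ is a finite nonempty chain of bridges joining them successively through members of $\mathcal C$; its length is the sum of the lengths of its bridges. The $\mathcal C$-propinquity $\mathsf\Lambda_{\mathcal C}(X,Y)$ is the infimum of the lengths of all $\mathcal C$-treks from $X$ to $Y$. **Theorem.** Let $\mathcal C$ be a nonempty class of Leibniz quantum compact metric spaces. For all $X=(\mathfrak A_1,\mathsf L_1)$,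 $Y=(\mathfrak A_2,\mathsf L_2)$, $Z=(\mathfrak A_3,\mathsf L_3)$ in $\mathcal C$: 1. $\mathsf\Lambda_{\mathcal C}(X,Y)\in[0,\infty)$, and $\mathsf\Lambda_{\mathcal C}(X,Y)\le\max\{\operatorname{diam}(\mathscr S(\mathfrak A_1),\mathsf{mk}_{\mathsf L_1}),\operatorname{diam}(\mathscr S(\mathfrak A_2),\mathsf{mk}_{\mathsf L_2})\}$; 2. $\mathsf\Lambda_{\mathcal C}(X,Y)=\mathsf\Lambda_{\mathcal C}(Y,X)$; 3. $\mathsf\Lambda_{\mathcal C}(X,Y)\le\mathsf\Lambda_{\mathcal C}(X,Z)+\mathsf\Lambda_{\mathcal C}(Z,Y)$; 4. $\mathsf\Lambda_{\mathcal C}(X,Y)=0$ if and only if there is an isometric isomorphism from $X$ to $Y$; and also if and only if there is a *-isomorphism $\Phi:\mathfrak A_1\to\mathfrak A_2$ with $\mathsf L_2\circ\Phi=\mathsf L_1$ on $\mathfrak{sa}(\mathfrak A_1)$. -/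

import Mathlib

open scoped ENNReal ComplexOrder

universe u

namespace Propinquity

section States

variable (A : Type u) [CStarAlgebra A]

/-- The state space of a unital C*-algebra: the continuous linear functionals that are positive
and take the value `1` at the unit. As a subtype of `WeakDual ℂ A` it carries the weak* topology. -/
abbrev State : Type u :=
  {φ : WeakDual ℂ A // (∀ a : A, 0 ≤ φ (star a * a)) ∧ φ 1 = 1}

noncomputable instance : CoeFun (State A) (fun _ => A → ℂ) := ⟨fun φ a => φ.1 a⟩

variable {A}

/-- The dual map `φ ↦ φ ∘ π` of a unital *-homomorphism `π`. -/
noncomputable def State.comp {B : Type u} [CStarAlgebra B] (φ : State B) (π : A →⋆ₐ[ℂ] B) :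
    State A :=
  ⟨StrongDual.toWeakDual
      ((WeakDual.toStrongDual φ.1).comp
        (⟨π.toAlgHom.toLinearMap, AddMonoidHomClass.continuous_of_bound π 1
          (fun a => by simpa only [one_mul] using NonUnitalStarAlgHom.norm_apply_le π a)⟩ : A →L[ℂ] B)), by
    refine ⟨fun a => ?_, ?_⟩
    · change 0 ≤ φ.1 (π (star a * a))
      rw [map_mul, map_star]
      exact φ.2.1 (π a)
    · change φ.1 (π 1) = 1
      rw [map_one]
      exact φ.2.2⟩

theorem State.comp_apply {B : Type u} [CStarAlgebra B] (φ : State B) (π : A →⋆ₐ[ℂ] B) (a : A) :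
    φ.comp π a = φ (π a) := rfl

end States

section LipNorms

variable {A : Type u} [CStarAlgebra A]

/-- The Jordan product `(ab + ba) / 2` of self-adjoint elements. -/
noncomputable def jordan (a b : selfAdjoint A) : selfAdjoint A :=
  ⟨(1 / 2 : ℂ) • ((a : A) * b + b * a), by
    rw [selfAdjoint.mem_iff, star_smul, star_add, star_mul, star_mul, selfAdjoint.star_val_eq,
      selfAdjoint.star_val_eq, add_comm]
    simp⟩

/-- The Lie product `(ab - ba) / (2i)` of self-adjoint elements. -/
noncomputable def lie (a b : selfAdjoint A) : selfAdjoint A :=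
  ⟨(1 / (2 * Complex.I) : ℂ) • ((a : A) * b - b * a), by
    rw [selfAdjoint.mem_iff, star_smul, star_sub, star_mul, star_mul, selfAdjoint.star_val_eq,
      selfAdjoint.star_val_eq, ← neg_sub, smul_neg, ← neg_smul]
    simp⟩

/-- A unital Lipschitz pair `(A, L)`: `L` is a densely defined seminorm on the self-adjoint part
of the nonzero unital C*-algebra `A`, regarded as a function on the whole self-adjoint part by
giving it the value `∞` off its domain (with `0 * ∞ = 0`), whose kernel is `ℝ 1`. -/
structure IsLipschitzPair (L : selfAdjoint A → ℝ≥0∞) : Prop where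
  nontrivial : Nontrivial A
  add_le : ∀ a b, L (a + b) ≤ L a + L b
  smul : ∀ (r : ℝ) (a), L (r • a) = ENNReal.ofReal |r| * L a
  dense_dom : Dense {a | L a < ∞}
  eq_zero_iff : ∀ a, L a = 0 ↔ ∃ r : ℝ, a = r • (1 : selfAdjoint A)

/-- The Monge-Kantorovich extended metric
`mk_L(φ, ψ) = sup { |φ(a) - ψ(a)| : a self-adjoint, L(a) ≤ 1 }` on the state space. -/
noncomputable def mkEDist (L : selfAdjoint A → ℝ≥0∞) (φ ψ : State A) : ℝ≥0∞ :=
  ⨆ (a : selfAdjoint A) (_ : L a ≤ 1), edist (φ a) (ψ a)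

/-- The Monge-Kantorovich metric as an extended (pseudo)metric structure, with the topology
that it induces. -/
@[reducible] noncomputable def mkSpace (L : selfAdjoint A → ℝ≥0∞) :
    PseudoEMetricSpace (State A) where
  edist := mkEDist L
  edist_self φ := by simp [mkEDist]
  edist_comm φ ψ := by simp only [mkEDist, edist_comm]
  edist_triangle φ ψ χ := by
    refine iSup₂_le fun a ha => (edist_triangle _ (ψ a) _).trans (add_le_add ?_ ?_)
    · exact le_iSup₂ (f := fun (a : selfAdjoint A) (_ : L a ≤ 1) => edist (φ a) (ψ a)) a ha
    · exact le_iSup₂ (f := fun (a : selfAdjoint A) (_ : L a ≤ 1) => edist (ψ a) (χ a)) a ha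

/-- `(A, L)` is a quantum compact metric space: a unital Lipschitz pair whose Monge-Kantorovich
metric induces the weak* topology on the state space. -/
structure IsQuantumCompactMetric (L : selfAdjoint A → ℝ≥0∞) : Prop extends IsLipschitzPair L where
  induces_weakStar :
    (mkSpace L).toUniformSpace.toTopologicalSpace = (instTopologicalSpaceSubtype : TopologicalSpace (State A))

/-- The Leibniz property of a generalized seminorm, for the Jordan and the Lie product. -/
structure HasLeibniz (L : selfAdjoint A → ℝ≥0∞) : Prop where
  jordan_le : ∀ a b, L (jordan a b) ≤
    ENNReal.ofReal ‖(a : A)‖ * L b + ENNReal.ofReal ‖(b : A)‖ * L a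
  lie_le : ∀ a b, L (lie a b) ≤
    ENNReal.ofReal ‖(a : A)‖ * L b + ENNReal.ofReal ‖(b : A)‖ * L a

end LipNorms

/-- Quantum compact metric spaces, bundled. -/
structure QuantumCompactMetricSpace : Type (u + 1) where
  /-- The underlying C*-algebra. -/
  carrier : Type u
  [cstar : CStarAlgebra carrier]
  /-- The Lip-norm. -/
  L : selfAdjoint carrier → ℝ≥0∞
  isQCMS : IsQuantumCompactMetric L

attribute [instance] QuantumCompactMetricSpace.cstar

namespace QuantumCompactMetricSpace

/-- Leibniz quantum compact metric spaces: the Lip-norm has the Leibniz property and is lower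
semicontinuous for the C*-norm. -/
structure IsLeibniz (X : QuantumCompactMetricSpace.{u}) : Prop where
  leibniz : HasLeibniz X.L
  lsc : LowerSemicontinuous X.L

/-- The set of self-adjoint elements `a` with `L(a) ≤ 1`. -/
def lipBall (X : QuantumCompactMetricSpace.{u}) : Set (selfAdjoint X.carrier) := {a | X.L a ≤ 1}

/-- The Hausdorff distance between sets of states, for the Monge-Kantorovich metric. -/
noncomputable def stateHausdorff (X : QuantumCompactMetricSpace.{u})
    (S T : Set (State X.carrier)) : ℝ≥0∞ :=
  @Metric.hausdorffEDist _ (mkSpace X.L) S T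

/-- The diameter of the state space, for the Monge-Kantorovich metric. -/
noncomputable def stateDiam (X : QuantumCompactMetricSpace.{u}) : ℝ≥0∞ :=
  ⨆ (φ : State X.carrier) (ψ : State X.carrier), mkEDist X.L φ ψ

/-- A *-isomorphism `Φ` from `X` onto `Y` is an isometric isomorphism when its dual map is an
isometry from the state space of `Y` onto the state space of `X`, for the Monge-Kantorovich
metrics. -/
def IsIsometricIso (X Y : QuantumCompactMetricSpace.{u})
    (Φ : X.carrier ≃⋆ₐ[ℂ] Y.carrier) : Prop :=
  @Isometry _ _ (mkSpace Y.L) (mkSpace X.L)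
      (fun φ : State Y.carrier => φ.comp (Φ : X.carrier →⋆ₐ[ℂ] Y.carrier)) ∧
    Function.Surjective (fun φ : State Y.carrier => φ.comp (Φ : X.carrier →⋆ₐ[ℂ] Y.carrier))

/-- The *-isomorphism `Φ` intertwines the Lip-norms: `L_Y ∘ Φ = L_X` on self-adjoint elements. -/
def Intertwines (X Y : QuantumCompactMetricSpace.{u})
    (Φ : X.carrier ≃⋆ₐ[ℂ] Y.carrier) : Prop :=
  ∀ a : selfAdjoint X.carrier, Y.L ⟨Φ a, IsSelfAdjoint.map a.2 Φ⟩ = X.L a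

end QuantumCompactMetricSpace

/-- The `1`-level of an element `ω` of a unital C*-algebra. -/
def oneLevel {D : Type u} [CStarAlgebra D] (ω : D) : Set (State D) :=
  {φ | φ (star (1 - ω) * (1 - ω)) = 0 ∧ φ ((1 - ω) * star (1 - ω)) = 0}

/-- A bridge from `A` to `B`: a unital C*-algebra `D`, a pivot element of `D` with nonempty
`1`-level, and unital *-monomorphisms of `A` and `B` into `D`. -/
structure Bridge (A B : Type u) [CStarAlgebra A] [CStarAlgebra B] : Type (u + 1) where
  /-- The C*-algebra of the bridge. -/
  D : Type u
  [cstar : CStarAlgebra D]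
  /-- The pivot element. -/
  pivot : D
  /-- The *-monomorphism on the domain. -/
  left : A →⋆ₐ[ℂ] D
  /-- The *-monomorphism on the codomain. -/
  right : B →⋆ₐ[ℂ] D
  left_injective : Function.Injective left
  right_injective : Function.Injective right
  oneLevel_nonempty : (oneLevel pivot).Nonempty

attribute [instance] Bridge.cstar

open QuantumCompactMetricSpace

namespace Bridge

variable {X Y : QuantumCompactMetricSpace.{u}}

/-- The reach of a bridge: the Hausdorff distance, in the norm of `D`, between
`π_X(lipBall X) ω` and `ω π_Y(lipBall Y)`. -/
noncomputable def reach (γ : Bridge X.carrier Y.carrier) : ℝ≥0∞ :=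
  Metric.hausdorffEDist
    ((fun a : selfAdjoint X.carrier => γ.left a * γ.pivot) '' X.lipBall)
    ((fun b : selfAdjoint Y.carrier => γ.pivot * γ.right b) '' Y.lipBall)

/-- The height of a bridge. -/
noncomputable def height (γ : Bridge X.carrier Y.carrier) : ℝ≥0∞ :=
  max (X.stateHausdorff Set.univ ((fun φ => State.comp φ γ.left) '' oneLevel γ.pivot))
    (Y.stateHausdorff Set.univ ((fun φ => State.comp φ γ.right) '' oneLevel γ.pivot))

/-- The length of a bridge. -/
noncomputable def length (γ : Bridge X.carrier Y.carrier) : ℝ≥0∞ := max γ.reach γ.height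

end Bridge

/-- `C`-treks from `X` to `Y`: nonempty finite chains of bridges between members of `C`, the
first of which starts at `X` and the last of which ends at `Y`. -/
inductive Trek (C : Set QuantumCompactMetricSpace.{u}) :
    QuantumCompactMetricSpace.{u} → QuantumCompactMetricSpace.{u} → Type (u + 1)
  | single {X Y : QuantumCompactMetricSpace.{u}} (hX : X ∈ C) (hY : Y ∈ C)
      (γ : Bridge X.carrier Y.carrier) : Trek C X Y
  | cons {X Y Z : QuantumCompactMetricSpace.{u}} (hX : X ∈ C)
      (γ : Bridge X.carrier Y.carrier) (Γ : Trek C Y Z) : Trek C X Z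

/-- The length of a trek: the sum of the lengths of its bridges. -/
noncomputable def Trek.length {C : Set QuantumCompactMetricSpace.{u}} :
    {X Y : QuantumCompactMetricSpace.{u}} → Trek C X Y → ℝ≥0∞
  | _, _, .single _ _ γ => γ.length
  | _, _, .cons _ γ Γ => γ.length + Γ.length

/-- The quantum Gromov-Hausdorff `C`-propinquity: the infimum of the lengths of all `C`-treks
from `X` to `Y`, a priori in `[0, ∞]`. -/
noncomputable def propinquity (C : Set QuantumCompactMetricSpace.{u})
    (X Y : QuantumCompactMetricSpace.{u}) : ℝ≥0∞ :=
  ⨅ Γ : Trek C X Y, Γ.length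

end Propinquity

/-! Symmetry and the triangle inequality are formal: treks concatenate, and a bridge reverses when
the two embeddings are exchanged and the pivot is replaced by its adjoint.

For the diameter bound, any two nonzero unital C*-algebras act faithfully and unitally on one
Hilbert space (`exists_common_embedding`). With pivot 1 the height vanishes, because states extend
along embeddings. The reach is at most the larger diameter, because an element of Lip-norm at most 1
lies within the diameter of a scalar, and scalars have Lip-norm 0.

For distance zero, a bridge of length below `lam` yields, at each scale `r`, a relation between
elements of Lip-norm at most `r`. The 1-level and the height show that it distorts norms by at most
`2 * r * lam`, and the Leibniz rule makes it compatible with the Jordan and Lie products after a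
change of scale (`Bridge.isApproxCorrespondence_near`). Such relations compose, and their errors add
(`IsApproxCorrespondence.comp`), so treks give them too. Treks of length below `1 / (n + 1)` are
then passed to the limit along a free ultrafilter; limits exist because norm-bounded parts of
Lip-balls are compact, by Arzelà–Ascoli on the state space
(`IsQuantumCompactMetric.isCompact_setOf_le`). The limit relation preserves norms and both products
and has dense domain and range, so the closure of its complexified graph in the product algebra is
the graph of a *-isomorphism (`IsLieJordanRelation.exists_starAlgEquiv`). The relation respects the
scale in both directions, hence so do the Lip-norms.

Finally, isometric isomorphisms and isomorphisms intertwining the Lip-norms coincide, because the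
unit ball of a lower semicontinuous Lip-norm consists exactly of the elements that are 1-Lipschitz
on states. This is a minimax argument (`IsLipschitzPair.le_one_of_forall_edist_le`). -/

namespace Propinquity

open QuantumCompactMetricSpace

/-! ### States: Cauchy–Schwarz, extension, norm attainment, compactness, the 1-level. -/

namespace State

variable {A : Type u} [CStarAlgebra A]

theorem map_nonneg' [PartialOrder A] [StarOrderedRing A] (φ : State A) {a : A} (ha : 0 ≤ a) :
    0 ≤ φ a := by
  obtain ⟨b, rfl⟩ := CStarAlgebra.nonneg_iff_eq_star_mul_self.mp ha
  exact φ.2.1 b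

/-- A state as a bundled positive linear map, for a compatible partial order. -/
noncomputable def toPositiveLinearMap [PartialOrder A] [StarOrderedRing A] (φ : State A) :
    A →ₚ[ℂ] ℂ :=
  PositiveLinearMap.mk₀ (WeakDual.toStrongDual φ.1).toLinearMap fun _ ha => φ.map_nonneg' ha

theorem map_add (φ : State A) (a b : A) : φ (a + b) = φ a + φ b := _root_.map_add φ.1 a b

theorem map_sub (φ : State A) (a b : A) : φ (a - b) = φ a - φ b := _root_.map_sub φ.1 a b

theorem map_smul (φ : State A) (c : ℂ) (a : A) : φ (c • a) = c * φ a := _root_.map_smul φ.1 c a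

theorem map_one (φ : State A) : φ 1 = 1 := φ.2.2

theorem map_star (φ : State A) (a : A) : φ (star a) = star (φ a) := by
  -- No order on `A` is assumed; the spectral order makes the elements `star b * b` the positive
  -- ones, so a state becomes a positive linear map.
  let _ := CStarAlgebra.spectralOrder A
  let _ := CStarAlgebra.spectralOrderedRing A
  exact StarHomClass.map_star φ.toPositiveLinearMap a

/-- Cauchy–Schwarz for the GNS pre-inner product of `φ`. -/
theorem norm_star_mul_sq_le (φ : State A) (a b : A) :
    ‖φ (star a * b)‖ ^ 2 ≤ (φ (star a * a)).re * (φ (star b * b)).re := by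
  let _ := CStarAlgebra.spectralOrder A
  let _ := CStarAlgebra.spectralOrderedRing A
  let f := φ.toPositiveLinearMap
  have h := norm_inner_le_norm (𝕜 := ℂ) (f.toPreGNS a) (f.toPreGNS b)
  have h1 : ‖f.toPreGNS a‖ ^ 2 = (φ (star a * a)).re := by
    rw [f.preGNS_norm_def, Real.sq_sqrt]
    · rfl
    · exact (Complex.nonneg_iff.mp (φ.2.1 a)).1
  have h2 : ‖f.toPreGNS b‖ ^ 2 = (φ (star b * b)).re := by
    rw [f.preGNS_norm_def, Real.sq_sqrt]
    · rfl
    · exact (Complex.nonneg_iff.mp (φ.2.1 b)).1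
  rw [← h1, ← h2, ← mul_pow]
  exact pow_le_pow_left₀ (norm_nonneg _) h 2

theorem re_star_mul_self_le (φ : State A) (a : A) : (φ (star a * a)).re ≤ ‖a‖ ^ 2 := by
  let _ := CStarAlgebra.spectralOrder A
  let _ := CStarAlgebra.spectralOrderedRing A
  have h : star a * a ≤ algebraMap ℝ A (‖a‖ ^ 2) := CStarAlgebra.star_mul_le_algebraMap_norm_sq
  have h' := φ.map_nonneg' (sub_nonneg.mpr h)
  have h3 : algebraMap ℝ A (‖a‖ ^ 2) = ((‖a‖ ^ 2 : ℝ) : ℂ) • (1 : A) := by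
    rw [Algebra.algebraMap_eq_smul_one, Complex.coe_smul]
  rw [map_sub, h3, map_smul, φ.map_one, mul_one, Complex.nonneg_iff, Complex.sub_re,
    Complex.ofReal_re] at h'
  linarith [h'.1]

theorem norm_apply_le (φ : State A) (a : A) : ‖φ a‖ ≤ ‖a‖ := by
  have h := φ.norm_star_mul_sq_le 1 a
  rw [star_one, one_mul, one_mul, φ.map_one, Complex.one_re, one_mul] at h
  exact le_of_sq_le_sq (h.trans (φ.re_star_mul_self_le a)) (norm_nonneg _)

theorem im_apply_eq_zero (φ : State A) {a : A} (ha : IsSelfAdjoint a) : (φ a).im = 0 := by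
  have h := φ.map_star a
  rw [ha.star_eq] at h
  exact Complex.conj_eq_iff_im.mp h.symm

/-- Translate `a` by `i t`: the squared norm grows to at most `‖a‖ ^ 2 + t ^ 2`, whereas `|f a + i
t| ^ 2` contains the linear term `2 t Im (f a)`, which is unbounded in `t` unless it vanishes. -/
theorem im_eq_zero_of_norm_le_one {f : A →L[ℂ] ℂ} (hf : ∀ a, ‖f a‖ ≤ ‖a‖) (h1 : f 1 = 1) {a : A}
    (ha : IsSelfAdjoint a) : (f a).im = 0 := by
  by_contra hne
  have key : ∀ t : ℝ, 2 * t * (f a).im ≤ ‖a‖ ^ 2 := fun t => by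
    have hx := hf (a + (Complex.I * t) • 1)
    have hfa : f (a + (Complex.I * t) • 1) = f a + Complex.I * t := by
      rw [_root_.map_add, _root_.map_smul, h1, smul_eq_mul, mul_one]
    have hn : ‖a + (Complex.I * t) • (1 : A)‖ ^ 2 ≤ ‖a‖ ^ 2 + t ^ 2 := by
      rcases subsingleton_or_nontrivial A with hA | hA
      · rw [Subsingleton.elim (a + (Complex.I * t) • (1 : A)) 0, norm_zero, zero_pow two_ne_zero]
        positivity
      rw [sq, ← CStarRing.norm_star_mul_self]
      have : star (a + (Complex.I * t) • (1 : A)) * (a + (Complex.I * t) • (1 : A))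
          = a * a + ((t ^ 2 : ℝ) : ℂ) • (1 : A) := by
        rw [star_add, star_smul, star_one, ha.star_eq]
        have hs : star (Complex.I * (t : ℂ)) = -(Complex.I * t) := by simp
        rw [hs, mul_add, add_mul, add_mul, smul_mul_smul_comm, mul_smul_comm, smul_mul_assoc,
          mul_one, one_mul, mul_one]
        have : -(Complex.I * (t : ℂ)) * (Complex.I * t) = ((t ^ 2 : ℝ) : ℂ) := by
          push_cast; linear_combination (-(t : ℂ) ^ 2) * Complex.I_sq
        rw [this, neg_smul]
        abel
      rw [this]
      refine (norm_add_le _ _).trans (add_le_add ?_ ?_)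
      · rw [sq]; exact norm_mul_le _ _
      · rw [norm_smul, norm_one, mul_one, Complex.norm_real, Real.norm_eq_abs, abs_of_nonneg]
        positivity
    have h3 : ‖f a + Complex.I * t‖ ^ 2 ≤ ‖a‖ ^ 2 + t ^ 2 := by
      rw [← hfa]
      exact (pow_le_pow_left₀ (norm_nonneg _) hx 2).trans hn
    rw [← Complex.normSq_eq_norm_sq, Complex.normSq_apply] at h3
    simp only [Complex.add_re, Complex.mul_re, Complex.I_re, Complex.ofReal_re, Complex.I_im,
      Complex.ofReal_im, Complex.add_im, Complex.mul_im] at h3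
    nlinarith [sq_nonneg (f a).re, sq_nonneg (f a).im]
  -- This `t` makes the linear term equal to `‖a‖ ^ 2 + 1`.
  have h := key ((‖a‖ ^ 2 + 1) / (2 * (f a).im))
  have : 2 * ((‖a‖ ^ 2 + 1) / (2 * (f a).im)) * (f a).im = ‖a‖ ^ 2 + 1 := by
    field_simp
  linarith

/-- For positive `b` the element `‖b‖ - b` has norm at most `‖b‖`, so `f b` lies within `‖b‖` of
`‖b‖` and its real part cannot be negative. -/
theorem nonneg_of_norm_le_one {f : A →L[ℂ] ℂ} (hf : ∀ a, ‖f a‖ ≤ ‖a‖) (h1 : f 1 = 1) (a : A) :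
    0 ≤ f (star a * a) := by
  let _ := CStarAlgebra.spectralOrder A
  let _ := CStarAlgebra.spectralOrderedRing A
  have hb : 0 ≤ star a * a := star_mul_self_nonneg a
  set b := star a * a
  have hb' : b ≤ algebraMap ℝ A ‖b‖ := IsSelfAdjoint.le_algebraMap_norm_self
  have hn : ‖algebraMap ℝ A ‖b‖ - b‖ ≤ ‖b‖ := by
    rw [CStarAlgebra.norm_le_iff_le_algebraMap _ (norm_nonneg b) (sub_nonneg.mpr hb')]
    exact sub_le_self _ hb
  have h := (hf _).trans hn
  rw [_root_.map_sub, Algebra.algebraMap_eq_smul_one, ← Complex.coe_smul, _root_.map_smul, h1,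
    smul_eq_mul, mul_one] at h
  have him := im_eq_zero_of_norm_le_one hf h1 (IsSelfAdjoint.of_nonneg hb)
  rw [Complex.nonneg_iff]
  refine ⟨?_, him.symm⟩
  have h2 := (Complex.abs_re_le_norm _).trans h
  rw [Complex.sub_re, Complex.ofReal_re, abs_le] at h2
  linarith

/-- A contractive functional that takes the value `1` at the unit is a state. -/
noncomputable def ofNormLeOne (f : A →L[ℂ] ℂ) (hf : ∀ a, ‖f a‖ ≤ ‖a‖) (h1 : f 1 = 1) : State A :=
  ⟨StrongDual.toWeakDual f, nonneg_of_norm_le_one hf h1, h1⟩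

/-- States extend along injective unital *-homomorphisms. -/
theorem exists_comp_eq {B : Type u} [CStarAlgebra B] (π : A →⋆ₐ[ℂ] B)
    (hπ : Function.Injective π) (φ : State A) : ∃ ψ : State B, ψ.comp π = φ := by
  let e : A ≃ₗ[ℂ] LinearMap.range π.toAlgHom.toLinearMap :=
    LinearEquiv.ofInjective π.toAlgHom.toLinearMap hπ
  have hbound : ∀ x, ‖((WeakDual.toStrongDual φ.1).toLinearMap.comp e.symm.toLinearMap) x‖
      ≤ 1 * ‖x‖ := fun x => by
    rw [one_mul]
    refine (φ.norm_apply_le (e.symm x)).trans (le_of_eq ?_)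
    rw [← NonUnitalStarAlgHom.norm_map π hπ]
    exact congrArg (fun y : LinearMap.range π.toAlgHom.toLinearMap => ‖(y : B)‖)
      (e.apply_symm_apply x)
  -- Hahn–Banach does not see positivity, but it keeps the norm, and norm at most 1 with value 1 at
  -- the unit forces positivity.
  obtain ⟨g, hg, hgn⟩ := exists_extension_norm_eq _ (LinearMap.mkContinuous _ 1 hbound)
  have hgπ : ∀ a, g (π a) = φ a := fun a => by
    refine (hg (e a)).trans ?_
    change φ (e.symm (e a)) = φ a
    rw [e.symm_apply_apply]
  have hg1 : ‖g‖ ≤ 1 := hgn.trans_le (LinearMap.mkContinuous_norm_le _ zero_le_one _)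
  refine ⟨ofNormLeOne g (fun a => ?_) ?_, Subtype.ext (DFunLike.ext _ _ fun a => hgπ a)⟩
  · exact (g.le_opNorm a).trans (mul_le_of_le_one_left (norm_nonneg a) hg1)
  · rw [← _root_.map_one π, hgπ, φ.map_one]

/-- One of `‖a‖`, `-‖a‖` is in the spectrum, hence is the value at `a` of a character of the
commutative C*-algebra generated by `a`; extend that character to a state of `A`. -/
theorem exists_norm_apply_eq [Nontrivial A] {a : A} (ha : IsSelfAdjoint a) :
    ∃ φ : State A, ‖φ a‖ = ‖a‖ := by
  have := ha.isStarNormal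
  obtain ⟨z, hz, hzn⟩ : ∃ z ∈ spectrum ℂ a, ‖z‖ = ‖a‖ := by
    have h := CStarAlgebra.norm_or_neg_norm_mem_spectrum (a := a)
    rcases h with h | h
    · exact ⟨_, (spectrum.algebraMap_mem_iff ℂ).mpr h, by simp⟩
    · exact ⟨_, (spectrum.algebraMap_mem_iff ℂ).mpr h, by simp⟩
  let E := StarAlgebra.elemental ℂ a
  have : Nontrivial E := inferInstance
  let a' : E := ⟨a, StarAlgebra.elemental.self_mem ℂ a⟩
  have hz' : z ∈ spectrum ℂ a' := by
    have : IsClosed (E : Set A) := StarAlgebra.elemental.isClosed ℂ a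
    rwa [StarSubalgebra.spectrum_eq]
  obtain ⟨χ, hχ⟩ := WeakDual.CharacterSpace.mem_spectrum_iff_exists.mp hz'
  have hχn : ‖WeakDual.toStrongDual (χ : WeakDual ℂ E)‖ ≤ 1 :=
    (WeakDual.CharacterSpace.norm_le_norm_one χ).trans_eq norm_one
  let φ : State E := ofNormLeOne (WeakDual.toStrongDual (χ : WeakDual ℂ E))
    (fun x => ((WeakDual.toStrongDual (χ : WeakDual ℂ E)).le_opNorm x).trans
      (mul_le_of_le_one_left (norm_nonneg x) hχn)) (_root_.map_one χ)
  obtain ⟨ψ, hψ⟩ := exists_comp_eq (StarSubalgebra.subtype E) Subtype.val_injective φ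
  refine ⟨ψ, ?_⟩
  have : ψ a = φ a' := by rw [← hψ]; rfl
  rw [this, ← hzn, ← hχ]
  rfl

instance [Nontrivial A] : Nonempty (State A) :=
  let ⟨φ, _⟩ := exists_norm_apply_eq (IsSelfAdjoint.one A); ⟨φ⟩

theorem norm_le_of_forall {a : A} (ha : IsSelfAdjoint a) {K : ℝ} (hK : 0 ≤ K)
    (h : ∀ φ : State A, ‖φ a‖ ≤ K) : ‖a‖ ≤ K := by
  rcases subsingleton_or_nontrivial A with hA | hA
  · rwa [Subsingleton.elim a 0, norm_zero]
  obtain ⟨φ, hφ⟩ := exists_norm_apply_eq ha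
  exact hφ ▸ h φ

theorem isClosed_setOf_isState :
    IsClosed {φ : WeakDual ℂ A | (∀ a : A, 0 ≤ φ (star a * a)) ∧ φ 1 = 1} := by
  have : {φ : WeakDual ℂ A | (∀ a : A, 0 ≤ φ (star a * a)) ∧ φ 1 = 1} =
      (⋂ a : A, (fun φ : WeakDual ℂ A => φ (star a * a)) ⁻¹' Set.Ici 0) ∩
        (fun φ : WeakDual ℂ A => φ 1) ⁻¹' {1} := by
    ext φ; simp
  rw [this]
  refine IsClosed.inter (isClosed_iInter fun a => ?_) ?_
  · exact (isClosed_Ici (a := (0 : ℂ))).preimage (WeakDual.eval_continuous (star a * a))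
  · exact isClosed_singleton.preimage (WeakDual.eval_continuous (1 : A))

instance : CompactSpace (State A) := by
  refine isCompact_iff_compactSpace.mp ((WeakDual.isCompact_closedBall (𝕜 := ℂ)
    (0 : StrongDual ℂ A) 1).of_isClosed_subset isClosed_setOf_isState fun f hf => ?_)
  refine mem_closedBall_zero_iff.mpr (?_ : ‖WeakDual.toStrongDual f‖ ≤ 1)
  refine ContinuousLinearMap.opNorm_le_bound _ zero_le_one fun x => ?_
  rw [one_mul]
  exact norm_apply_le (⟨f, hf⟩ : State A) x

theorem continuous_apply (a : A) : Continuous fun φ : State A => φ a :=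
  (WeakDual.eval_continuous a).comp continuous_subtype_val

/-- States of the 1-level do not see the pivot: by Cauchy–Schwarz, `φ (x * (1 - ω))` is controlled
by `φ (star (1 - ω) * (1 - ω)) = 0`. -/
theorem apply_mul_eq_of_mem_oneLevel {ω : A} {φ : State A} (hφ : φ ∈ oneLevel ω) (x : A) :
    φ (x * ω) = φ x := by
  have h := φ.norm_star_mul_sq_le (star x) (1 - ω)
  rw [hφ.1, Complex.zero_re, mul_zero, star_star, mul_sub, mul_one, map_sub] at h
  have h0 : ‖φ x - φ (x * ω)‖ = 0 := by
    have := norm_nonneg (φ x - φ (x * ω))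
    nlinarith
  exact (sub_eq_zero.mp (norm_eq_zero.mp h0)).symm

theorem apply_mul_eq_of_mem_oneLevel' {ω : A} {φ : State A} (hφ : φ ∈ oneLevel ω) (x : A) :
    φ (ω * x) = φ x := by
  have h := φ.norm_star_mul_sq_le (star (1 - ω)) x
  rw [star_star, hφ.2, Complex.zero_re, zero_mul, sub_mul, one_mul, map_sub] at h
  have h0 : ‖φ x - φ (ω * x)‖ = 0 := by
    have := norm_nonneg (φ x - φ (ω * x))
    nlinarith
  exact (sub_eq_zero.mp (norm_eq_zero.mp h0)).symm

end State

/-! ### States on self-adjoint elements, and convexity of the state space. -/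

namespace State

variable {A : Type u} [CStarAlgebra A]

theorem apply_eq_re (φ : State A) (a : selfAdjoint A) : φ a = ((φ a).re : ℂ) :=
  (Complex.ext rfl (by rw [Complex.ofReal_im]; exact φ.im_apply_eq_zero a.2))

theorem edist_apply (φ ψ : State A) (a : selfAdjoint A) :
    edist (φ a) (ψ a) = ENNReal.ofReal |(φ a).re - (ψ a).re| := by
  rw [edist_dist, dist_eq_norm, φ.apply_eq_re, ψ.apply_eq_re, ← Complex.ofReal_sub,
    Complex.norm_real, Real.norm_eq_abs, Complex.ofReal_re, Complex.ofReal_re]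

theorem norm_apply_eq (φ : State A) (a : selfAdjoint A) : ‖φ a‖ = |(φ a).re| := by
  rw [φ.apply_eq_re, Complex.norm_real, Real.norm_eq_abs, Complex.ofReal_re]

theorem re_add (φ : State A) (a b : selfAdjoint A) :
    (φ (a + b : selfAdjoint A)).re = (φ a).re + (φ b).re := by
  rw [AddSubgroup.coe_add, φ.map_add, Complex.add_re]

theorem re_sub (φ : State A) (a b : selfAdjoint A) :
    (φ (a - b : selfAdjoint A)).re = (φ a).re - (φ b).re := by
  rw [AddSubgroup.coe_sub, φ.map_sub, Complex.sub_re]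

theorem re_smul (φ : State A) (r : ℝ) (a : selfAdjoint A) :
    (φ (r • a : selfAdjoint A)).re = r * (φ a).re := by
  rw [selfAdjoint.val_smul, ← Complex.coe_smul, φ.map_smul, Complex.re_ofReal_mul]

theorem re_one (φ : State A) : (φ (1 : selfAdjoint A)).re = 1 := by
  rw [selfAdjoint.val_one, φ.map_one, Complex.one_re]

theorem norm_selfAdjoint_le {a : selfAdjoint A} {K : ℝ} (hK : 0 ≤ K)
    (h : ∀ φ : State A, |(φ a).re| ≤ K) : ‖a‖ ≤ K :=
  norm_le_of_forall a.2 hK fun φ => (φ.norm_apply_eq a).trans_le (h φ)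

theorem abs_re_le (φ : State A) (a : selfAdjoint A) : |(φ a).re| ≤ ‖a‖ :=
  (φ.norm_apply_eq a).symm.trans_le (φ.norm_apply_le a)

theorem convex_setOf_isState :
    Convex ℝ {φ : WeakDual ℂ A | (∀ a : A, 0 ≤ φ (star a * a)) ∧ φ 1 = 1} := by
  rintro φ ⟨hφ, hφ1⟩ ψ ⟨hψ, hψ1⟩ s t hs ht hst
  have key : ∀ x, (s • φ + t • ψ) x = (s : ℂ) * φ x + (t : ℂ) * ψ x := fun x => rfl
  refine ⟨fun a => ?_, ?_⟩
  · rw [key]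
    exact add_nonneg (mul_nonneg (by exact_mod_cast hs) (hφ a))
      (mul_nonneg (by exact_mod_cast ht) (hψ a))
  · rw [key, hφ1, hψ1, mul_one, mul_one]
    exact_mod_cast hst

/-- The convex combination `(1 - t) φ + t ψ` of states. -/
noncomputable def mix (φ ψ : State A) (t : Set.Icc (0 : ℝ) 1) : State A :=
  ⟨(1 - t : ℝ) • φ.1 + (t : ℝ) • ψ.1,
    convex_setOf_isState φ.2 ψ.2 (sub_nonneg.mpr t.2.2) t.2.1 (sub_add_cancel _ _)⟩

theorem mix_apply (φ ψ : State A) (t : Set.Icc (0 : ℝ) 1) (x : A) :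
    mix φ ψ t x = ((1 - t : ℝ) : ℂ) * φ x + ((t : ℝ) : ℂ) * ψ x := rfl

theorem re_smul_add_smul_apply (s t : ℝ) (φ ψ : WeakDual ℂ A) (x : A) :
    ((s • φ + t • ψ) x).re = s * (φ x).re + t * (ψ x).re := by
  change ((s : ℂ) * φ x + (t : ℂ) * ψ x).re = _
  rw [Complex.add_re, Complex.re_ofReal_mul, Complex.re_ofReal_mul]

theorem continuous_mix (φ ψ : State A) : Continuous (mix φ ψ) := by
  refine Continuous.subtype_mk (WeakDual.continuous_of_continuous_eval fun x => ?_) _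
  change Continuous fun t : Set.Icc (0 : ℝ) 1 =>
    ((1 - t : ℝ) : ℂ) * φ x + ((t : ℝ) : ℂ) * ψ x
  fun_prop

end State

/-! ### Lip-norms: finite diameter, compact balls, recovery from the metric. -/

section LipNorms

variable {A : Type u} [CStarAlgebra A] {L : selfAdjoint A → ℝ≥0∞}

theorem edist_apply_le_mkEDist {a : selfAdjoint A} (ha : L a ≤ 1) (φ ψ : State A) :
    edist (φ a) (ψ a) ≤ mkEDist L φ ψ :=
  le_iSup₂ (f := fun (a : selfAdjoint A) (_ : L a ≤ 1) => edist (φ a) (ψ a)) a ha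

namespace IsLipschitzPair

variable (hL : IsLipschitzPair L)
include hL

theorem map_zero : L 0 = 0 := (hL.eq_zero_iff 0).mpr ⟨0, (zero_smul _ _).symm⟩

theorem map_smul_one (r : ℝ) : L (r • (1 : selfAdjoint A)) = 0 :=
  (hL.eq_zero_iff _).mpr ⟨r, rfl⟩

theorem map_one : L 1 = 0 := by simpa using hL.map_smul_one 1

theorem map_neg (a : selfAdjoint A) : L (-a) = L a := by
  simpa using hL.smul (-1) a

theorem add_smul_one_le (a : selfAdjoint A) (r : ℝ) : L (a + r • 1) ≤ L a := by
  simpa [hL.map_smul_one r] using hL.add_le a (r • 1)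

theorem edist_apply_le {a : selfAdjoint A} {r : ℝ} (hr : 0 < r) (ha : L a ≤ ENNReal.ofReal r)
    (φ ψ : State A) : edist (φ a) (ψ a) ≤ ENNReal.ofReal r * mkEDist L φ ψ := by
  have h1 : L (r⁻¹ • a) ≤ 1 := by
    rw [hL.smul, abs_of_pos (inv_pos.mpr hr)]
    refine (mul_le_mul_right ha _).trans ?_
    rw [← ENNReal.ofReal_mul (inv_nonneg.mpr hr.le), inv_mul_cancel₀ hr.ne', ENNReal.ofReal_one]
  have h2 := edist_apply_le_mkEDist h1 φ ψ
  rw [State.edist_apply, State.re_smul, State.re_smul, ← mul_sub, abs_mul,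
    abs_of_pos (inv_pos.mpr hr)] at h2
  refine le_trans (le_of_eq ?_) (mul_le_mul_right h2 _)
  rw [State.edist_apply, ← ENNReal.ofReal_mul hr.le, ← mul_assoc, mul_inv_cancel₀ hr.ne', one_mul]

end IsLipschitzPair

namespace IsQuantumCompactMetric

variable (hL : IsQuantumCompactMetric L)
include hL

theorem eventually_mkEDist_lt (φ : State A) {ε : ℝ≥0∞} (hε : 0 < ε) :
    ∀ᶠ ψ in nhds φ, mkEDist L φ ψ < ε := by
  rw [← hL.induces_weakStar]
  let _ := mkSpace L
  filter_upwards [Metric.eball_mem_nhds φ hε] with ψ hψ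
  exact (edist_comm φ ψ).trans_lt hψ

/-- The segment from `φ` to `ψ` is weak* continuous, so for small `t > 0` its point at parameter `t`
is within 1 of `φ`; that distance dominates `t` times the distance from `φ` to `ψ`. -/
theorem mkEDist_lt_top (φ ψ : State A) : mkEDist L φ ψ < ∞ := by
  have h0 : State.mix φ ψ 0 = φ := Subtype.ext (DFunLike.ext _ _ fun x => by
    refine (State.mix_apply φ ψ 0 x).trans ?_
    simp)
  have h := ((State.continuous_mix φ ψ).tendsto 0).eventually
    (p := fun χ => mkEDist L φ χ < 1) (by rw [h0]; exact hL.eventually_mkEDist_lt φ one_pos)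
  obtain ⟨δ, hδ, hball⟩ := Metric.eventually_nhds_iff.mp h
  let t : Set.Icc (0 : ℝ) 1 := ⟨min (δ / 2) 1, by positivity, min_le_right _ _⟩
  have ht : 0 < (t : ℝ) := by positivity
  have htd : dist t 0 < δ := by
    rw [Subtype.dist_eq, Real.dist_eq, Set.Icc.coe_zero, sub_zero, abs_of_pos ht]
    exact (min_le_left _ _).trans_lt (half_lt_self hδ)
  have h1 := hball htd
  have h2 : ENNReal.ofReal t * mkEDist L φ ψ ≤ 1 := by
    rw [mkEDist, ENNReal.mul_iSup]
    refine iSup_le fun a => ?_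
    rw [ENNReal.mul_iSup]
    refine iSup_le fun ha => le_trans (le_of_eq ?_) ((edist_apply_le_mkEDist ha _ _).trans h1.le)
    rw [State.edist_apply, State.edist_apply, ← ENNReal.ofReal_mul ht.le, State.mix_apply,
      Complex.add_re, Complex.re_ofReal_mul, Complex.re_ofReal_mul, ← abs_of_pos ht, ← abs_mul,
      abs_of_pos ht]
    congr 2
    ring
  by_contra htop
  rw [not_lt_top_iff.mp htop, ENNReal.mul_top (by simpa using ht)] at h2
  simp at h2

/-- By weak* compactness finitely many unit balls cover the state space, and their centres are at
finite distance from a base point. -/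
theorem exists_forall_mkEDist_le : ∃ d : ℝ, ∀ φ ψ, mkEDist L φ ψ ≤ ENNReal.ofReal d := by
  have := hL.nontrivial
  obtain ⟨φ₀⟩ : Nonempty (State A) := inferInstance
  obtain ⟨s, -, hs⟩ := isCompact_univ.elim_nhds_subcover
    (fun φ : State A => {ψ | mkEDist L φ ψ < 1}) (fun φ _ => hL.eventually_mkEDist_lt φ one_pos)
  let d : ℝ≥0∞ := ∑ φ ∈ s, (mkEDist L φ₀ φ + 1)
  have hd : d < ∞ := ENNReal.sum_lt_top.mpr fun φ _ =>
    ENNReal.add_lt_top.mpr ⟨hL.mkEDist_lt_top _ _, ENNReal.one_lt_top⟩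
  have key : ∀ ψ, mkEDist L φ₀ ψ ≤ d := fun ψ => by
    obtain ⟨φ, hφ, hψ⟩ := Set.mem_iUnion₂.mp (hs (Set.mem_univ ψ))
    let _ := mkSpace L
    calc mkEDist L φ₀ ψ ≤ mkEDist L φ₀ φ + mkEDist L φ ψ := edist_triangle φ₀ φ ψ
      _ ≤ mkEDist L φ₀ φ + 1 := by gcongr; exact le_of_lt hψ
      _ ≤ d := Finset.single_le_sum (f := fun φ => mkEDist L φ₀ φ + 1) (fun _ _ => zero_le) hφ
  refine ⟨(d + d).toReal, fun φ ψ => ?_⟩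
  rw [ENNReal.ofReal_toReal (ENNReal.add_lt_top.mpr ⟨hd, hd⟩).ne]
  let _ := mkSpace L
  calc mkEDist L φ ψ ≤ mkEDist L φ φ₀ + mkEDist L φ₀ ψ := edist_triangle φ φ₀ ψ
    _ ≤ d + d := add_le_add ((edist_comm φ φ₀).trans_le (key φ)) (key ψ)

/-- The norm-bounded parts of the balls of a lower semicontinuous Lip-norm are norm compact. -/
theorem isCompact_setOf_le (hlsc : LowerSemicontinuous L) {r : ℝ} (hr : 0 < r) (K : ℝ) :
    IsCompact {a : selfAdjoint A | L a ≤ ENNReal.ofReal r ∧ ‖a‖ ≤ K} := by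
  have : CompleteSpace (selfAdjoint A) := (isClosed_eq continuous_star continuous_id :
    IsClosed {a : A | star a = a}).completeSpace_coe
  -- The function representation on states is isometric, since states compute the norm of
  -- self-adjoint elements; compactness becomes a question for Arzelà–Ascoli.
  let F : selfAdjoint A → BoundedContinuousFunction (State A) ℝ := fun a =>
    BoundedContinuousFunction.mkOfCompact
      ⟨fun φ => (φ a).re, Complex.continuous_re.comp (State.continuous_apply (a : A))⟩
  have hF : ∀ a φ, F a φ = (φ a).re := fun _ _ => rfl
  have hiso : Isometry F := by
    refine Isometry.of_dist_eq fun a b => le_antisymm ?_ ?_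
    · rw [BoundedContinuousFunction.dist_le dist_nonneg]
      intro φ
      rw [hF, hF, Real.dist_eq, ← φ.re_sub, dist_eq_norm]
      exact φ.abs_re_le _
    · rw [dist_eq_norm a b]
      refine State.norm_selfAdjoint_le dist_nonneg fun φ => ?_
      rw [φ.re_sub, ← hF, ← hF, ← Real.dist_eq]
      exact BoundedContinuousFunction.dist_coe_le_dist φ
  set T : Set (selfAdjoint A) := {a | L a ≤ ENNReal.ofReal r ∧ ‖a‖ ≤ K}
  have hT : IsClosed T := by
    have h1 : IsClosed (L ⁻¹' Set.Iic (ENNReal.ofReal r)) := hlsc.isClosed_preimage _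
    have h2 : IsClosed {a : selfAdjoint A | ‖a‖ ≤ K} :=
      isClosed_le continuous_norm continuous_const
    exact h1.inter h2
  rw [hiso.isEmbedding.isInducing.isCompact_iff]
  refine BoundedContinuousFunction.arzela_ascoli₂ (Set.Icc (-K) K) isCompact_Icc _ ?_ ?_ ?_
  · exact hiso.isClosedEmbedding.isClosedMap _ hT
  · rintro _ φ ⟨a, ha, rfl⟩
    rw [hF]
    exact abs_le.mp ((φ.abs_re_le a).trans ha.2)
  -- Equicontinuity: each element is `r`-Lipschitz for the Monge–Kantorovich metric, whose balls are
  -- weak* neighbourhoods.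
  · intro φ
    rw [Metric.equicontinuousAt_iff_right]
    intro ε hε
    have hpos : 0 < ENNReal.ofReal (ε / r) := ENNReal.ofReal_pos.mpr (div_pos hε hr)
    filter_upwards [hL.eventually_mkEDist_lt φ hpos] with ψ hψ
    rintro ⟨_, a, ha, rfl⟩
    have h := hL.edist_apply_le hr ha.1 φ ψ
    have h2 : ENNReal.ofReal r * mkEDist L φ ψ < ENNReal.ofReal ε := by
      have h3 : ENNReal.ofReal ε = ENNReal.ofReal r * ENNReal.ofReal (ε / r) := by
        rw [← ENNReal.ofReal_mul hr.le, mul_div_cancel₀ _ hr.ne']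
      rw [h3]
      exact (ENNReal.mul_lt_mul_iff_right (by simpa using hr) ENNReal.ofReal_ne_top).mpr hψ
    have h4 := h.trans_lt h2
    rw [State.edist_apply, ENNReal.ofReal_lt_ofReal_iff hε] at h4
    exact h4

end IsQuantumCompactMetric

/-- For a lower semicontinuous Lip-norm, the elements that are `1`-Lipschitz for the
Monge-Kantorovich metric have Lip-norm at most `1`. -/
theorem IsLipschitzPair.le_one_of_forall_edist_le (hL : IsLipschitzPair L)
    (hlsc : LowerSemicontinuous L) {a : selfAdjoint A}
    (ha : ∀ φ ψ : State A, edist (φ a) (ψ a) ≤ mkEDist L φ ψ) : L a ≤ 1 := by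
  have := hL.nontrivial
  have hclosed : IsClosed (L ⁻¹' Set.Iic 1) := hlsc.isClosed_preimage 1
  change a ∈ L ⁻¹' Set.Iic 1
  rw [← hclosed.closure_eq, Metric.mem_closure_iff]
  intro ε hε
  let S : Set (WeakDual ℂ A) := {φ | (∀ a : A, 0 ≤ φ (star a * a)) ∧ φ 1 = 1}
  have hScomp : IsCompact S :=
    isCompact_iff_compactSpace.mpr (inferInstanceAs (CompactSpace (State A)))
  -- A `y` in the unit ball with `f p y > -(ε / 2)` for all pairs of states makes `a - y` oscillate
  -- by less than `ε / 2`. The hypothesis only gives an `x` depending on the pair; minimax exchanges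
  -- the quantifiers.
  let f : WeakDual ℂ A × WeakDual ℂ A → selfAdjoint A → ℝ := fun p x =>
    (p.1 (x - a : selfAdjoint A)).re - (p.2 (x - a : selfAdjoint A)).re
  have hcont : ∀ x, Continuous fun p => f p x := fun x =>
    (Complex.continuous_re.comp ((WeakDual.eval_continuous _).comp continuous_fst)).sub
      (Complex.continuous_re.comp ((WeakDual.eval_continuous _).comp continuous_snd))
  have : ContinuousSMul ℝ (WeakDual ℂ A) := ⟨by
    change Continuous fun p : ℝ × WeakDual ℂ A => (p.1 : ℂ) • p.2
    fun_prop⟩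
  let modProd : Module ℝ (WeakDual ℂ A × WeakDual ℂ A) := Prod.instModule
  have : ContinuousSMul ℝ (WeakDual ℂ A × WeakDual ℂ A) := Prod.continuousSMul
  have hex : ∀ p ∈ S ×ˢ S, ∃ x ∈ L ⁻¹' Set.Iic 1, -(ε / 2) < f p x := by
    rintro ⟨φ, ψ⟩ ⟨hφ, hψ⟩
    let φ' : State A := ⟨φ, hφ⟩
    let ψ' : State A := ⟨ψ, hψ⟩
    have hf : ∀ x, f (φ, ψ) x = ((φ' x).re - (ψ' x).re) - ((φ' a).re - (ψ' a).re) := fun x => by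
      change (φ' (x - a : selfAdjoint A)).re - (ψ' (x - a : selfAdjoint A)).re = _
      rw [State.re_sub, State.re_sub]
      ring
    simp only [hf]
    set δ := (φ' a).re - (ψ' a).re
    have hle : δ ≤ |δ| := le_abs_self _
    rcases lt_or_ge (|δ| - ε / 2) 0 with h0 | h0
    · refine ⟨0, (hL.map_zero.trans_le zero_le_one : L 0 ≤ 1), ?_⟩
      have h1 : (φ' (0 : selfAdjoint A)).re = 0 := by simp
      have h2 : (ψ' (0 : selfAdjoint A)).re = 0 := by simp
      rw [h1, h2]
      linarith
    have hlt : ENNReal.ofReal (|δ| - ε / 2) < mkEDist L φ' ψ' := by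
      refine lt_of_lt_of_le ?_ (ha φ' ψ')
      rw [State.edist_apply]
      exact (ENNReal.ofReal_lt_ofReal_iff_of_nonneg h0).mpr (by linarith)
    obtain ⟨x, hx⟩ := lt_iSup_iff.mp hlt
    obtain ⟨hx1, hx2⟩ := lt_iSup_iff.mp hx
    rw [State.edist_apply, ENNReal.ofReal_lt_ofReal_iff_of_nonneg h0] at hx2
    rcases le_total 0 ((φ' x).re - (ψ' x).re) with hs | hs
    · rw [abs_of_nonneg hs] at hx2
      exact ⟨x, hx1, by linarith⟩
    · rw [abs_of_nonpos hs] at hx2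
      refine ⟨-x, ((hL.map_neg x).trans_le hx1 : L (-x) ≤ 1), ?_⟩
      have h1 : (φ' (-x : selfAdjoint A)).re = -(φ' x).re := by simp
      have h2 : (ψ' (-x : selfAdjoint A)).re = -(ψ' x).re := by simp
      rw [h1, h2]
      linarith
  have hSS : Convex ℝ (S ×ˢ S) := State.convex_setOf_isState.prod State.convex_setOf_isState
  have hlow : ∀ y ∈ L ⁻¹' Set.Iic 1, LowerSemicontinuousOn (fun p => f p y) (S ×ˢ S) :=
    fun y _ => (hcont y).lowerSemicontinuous.lowerSemicontinuousOn _
  have hconv : ∀ y ∈ L ⁻¹' Set.Iic 1, QuasiconvexOn ℝ (S ×ˢ S) fun p => f p y := by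
    intro y _ r p hp q hq s t hs ht hst
    refine ⟨hSS hp.1 hq.1 hs ht hst, ?_⟩
    have hf : f (s • p + t • q) y = s * f p y + t * f q y := by
      change ((s • p.1 + t • q.1) ((y - a : selfAdjoint A) : A)).re -
        ((s • p.2 + t • q.2) ((y - a : selfAdjoint A) : A)).re = _
      rw [State.re_smul_add_smul_apply, State.re_smul_add_smul_apply]
      ring
    change f (s • p + t • q) y ≤ r
    have h1 : f p y ≤ r := hp.2
    have h2 : f q y ≤ r := hq.2
    calc f (s • p + t • q) y ≤ s * r + t * r := by rw [hf]; gcongr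
      _ = r := by rw [← add_mul, hst, one_mul]
  have hY : Convex ℝ (L ⁻¹' Set.Iic 1) := by
    intro x hx y hy s t hs ht hst
    refine (hL.add_le _ _).trans ?_
    rw [hL.smul, hL.smul, abs_of_nonneg hs, abs_of_nonneg ht]
    refine (add_le_add (mul_le_mul_right hx _) (mul_le_mul_right hy _)).trans ?_
    rw [mul_one, mul_one, ← ENNReal.ofReal_add hs ht, hst, ENNReal.ofReal_one]
  have hup : ∀ p ∈ S ×ˢ S, UpperSemicontinuousOn (fun y => f p y) (L ⁻¹' Set.Iic 1) := by
    intro p _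
    have h : Continuous fun y => f p y := by
      have hx : Continuous fun y : selfAdjoint A => ((y - a : selfAdjoint A) : A) := by fun_prop
      exact (Complex.continuous_re.comp ((map_continuous p.1).comp hx)).sub
        (Complex.continuous_re.comp ((map_continuous p.2).comp hx))
    exact h.upperSemicontinuous.upperSemicontinuousOn _
  have hconc : ∀ p ∈ S ×ˢ S, QuasiconcaveOn ℝ (L ⁻¹' Set.Iic 1) fun y => f p y := by
    rintro ⟨φ, ψ⟩ ⟨hφ, hψ⟩
    refine ConcaveOn.quasiconcaveOn ⟨hY, fun x _ y _ s t _ _ hst => le_of_eq ?_⟩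
    let φ' : State A := ⟨φ, hφ⟩
    let ψ' : State A := ⟨ψ, hψ⟩
    have hf : ∀ x, f (φ, ψ) x = ((φ' x).re - (ψ' x).re) - ((φ' a).re - (ψ' a).re) := fun x => by
      change (φ' (x - a : selfAdjoint A)).re - (ψ' (x - a : selfAdjoint A)).re = _
      rw [State.re_sub, State.re_sub]
      ring
    simp only [hf, State.re_add, State.re_smul, smul_eq_mul]
    linear_combination (-((φ' a).re - (ψ' a).re)) * hst
  -- By compactness, finitely many `x` serve all pairs, as this form of Sion's theorem requires.
  obtain ⟨b, hbY, hbfin, hbcov⟩ := (hScomp.prod hScomp).elim_finite_subcover_image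
    (b := L ⁻¹' Set.Iic 1) (c := fun x => {p | -(ε / 2) < f p x})
    (fun x _ => isOpen_lt continuous_const (hcont x))
    (fun p hp => by
      obtain ⟨x, hx, hpx⟩ := hex p hp
      exact Set.mem_iUnion₂.mpr ⟨x, hx, hpx⟩)
  obtain ⟨φ₀⟩ : Nonempty (State A) := inferInstance
  have hne : (S ×ˢ S).Nonempty := ⟨(φ₀.1, φ₀.1), φ₀.2, φ₀.2⟩
  obtain ⟨y, hy, hfy⟩ := Sion.exists_lt_iInf_of_lt_iInf_of_finite (t := -(ε / 2))
    hne (hScomp.prod hScomp) hlow hconv hY hup hconc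
    hSS hbfin hbY
    (fun p hp => by
      obtain ⟨x, hx, hpx⟩ := Set.mem_iUnion₂.mp (hbcov hp)
      exact ⟨x, hx, hpx⟩)
  have hosc : ∀ φ ψ : State A, (φ (a - y : selfAdjoint A)).re - (ψ (a - y : selfAdjoint A)).re
      < ε / 2 := fun φ ψ => by
    have h : -(ε / 2) < (φ (y - a : selfAdjoint A)).re - (ψ (y - a : selfAdjoint A)).re :=
      hfy (φ.1, ψ.1) ⟨φ.2, ψ.2⟩
    rw [State.re_sub, State.re_sub] at h ⊢
    linarith
  -- Small oscillation puts `a - y` near the scalar `φ₀ (a - y)`, and adding a scalar does not raise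
  -- `L`.
  refine ⟨y + (φ₀ (a - y : selfAdjoint A)).re • 1, (hL.add_smul_one_le _ _).trans hy, ?_⟩
  rw [dist_eq_norm]
  refine (State.norm_selfAdjoint_le (half_pos hε).le fun φ => ?_).trans_lt (half_lt_self hε)
  rw [← sub_sub, State.re_sub, State.re_smul, State.re_one, mul_one, abs_le]
  exact ⟨by linarith [hosc φ₀ φ], (hosc φ φ₀).le⟩

end LipNorms

theorem le_of_unitBall_subset {A : Type u} [CStarAlgebra A] {L L' : selfAdjoint A → ℝ≥0∞}
    (hL : ∀ (r : ℝ) (a), L (r • a) = ENNReal.ofReal |r| * L a)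
    (hL' : ∀ (r : ℝ) (a), L' (r • a) = ENNReal.ofReal |r| * L' a)
    (h : ∀ a, L a ≤ 1 → L' a ≤ 1) (a : selfAdjoint A) : L' a ≤ L a := by
  refine le_of_forall_gt_imp_ge_of_dense fun c hc => ?_
  rcases eq_or_ne c ∞ with rfl | hc'
  · exact le_top
  obtain ⟨r, hr⟩ : ∃ r : ℝ, c = ENNReal.ofReal r := ⟨c.toReal, (ENNReal.ofReal_toReal hc').symm⟩
  have hr0 : 0 < r := ENNReal.ofReal_pos.mp (hr ▸ (zero_le.trans_lt hc))
  have h0 : ENNReal.ofReal r ≠ 0 := by simpa using hr0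
  have key : ∀ x : ℝ≥0∞, ENNReal.ofReal |r⁻¹| * x ≤ 1 ↔ x ≤ c := fun x => by
    rw [abs_of_pos (inv_pos.mpr hr0), ENNReal.ofReal_inv_of_pos hr0, mul_comm, ← div_eq_mul_inv,
      ENNReal.div_le_iff h0 ENNReal.ofReal_ne_top, one_mul, hr]
  have h1 := h (r⁻¹ • a) (by rw [hL, key]; exact hc.le)
  rwa [hL', key] at h1

/-! ### Isometric isomorphisms versus intertwining of Lip-norms; diameters. -/

namespace QuantumCompactMetricSpace

variable {X Y : QuantumCompactMetricSpace.{u}}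

instance (X : QuantumCompactMetricSpace.{u}) : Nontrivial X.carrier := X.isQCMS.nontrivial

/-- The map induced by a *-isomorphism on self-adjoint elements. -/
def saMap (Φ : X.carrier ≃⋆ₐ[ℂ] Y.carrier) (a : selfAdjoint X.carrier) : selfAdjoint Y.carrier :=
  ⟨Φ a, IsSelfAdjoint.map a.2 Φ⟩

theorem saMap_saMap_symm (Φ : X.carrier ≃⋆ₐ[ℂ] Y.carrier) (b : selfAdjoint Y.carrier) :
    saMap Φ (saMap Φ.symm b) = b := Subtype.ext (Φ.apply_symm_apply _)

theorem saMap_smul (Φ : X.carrier ≃⋆ₐ[ℂ] Y.carrier) (r : ℝ) (a : selfAdjoint X.carrier) :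
    saMap Φ (r • a) = r • saMap Φ a := by
  refine Subtype.ext ?_
  change Φ (r • (a : X.carrier)) = r • Φ a
  rw [← Complex.coe_smul, ← Complex.coe_smul, map_smul]

theorem comp_surjective (Φ : X.carrier ≃⋆ₐ[ℂ] Y.carrier) :
    Function.Surjective (fun φ : State Y.carrier => φ.comp (Φ : X.carrier →⋆ₐ[ℂ] Y.carrier)) :=
  fun φ => ⟨φ.comp (Φ.symm : Y.carrier →⋆ₐ[ℂ] X.carrier),
    Subtype.ext (DFunLike.ext _ _ fun a => congrArg φ.1 (Φ.symm_apply_apply a))⟩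

/-- Only the metrics are transported by the hypothesis. Being 1-Lipschitz on states is expressed by
the metric alone, and by lower semicontinuity it recovers the unit balls, hence by homogeneity the
Lip-norms. -/
theorem IsIsometricIso.intertwines (hX : X.IsLeibniz) (hY : Y.IsLeibniz)
    {Φ : X.carrier ≃⋆ₐ[ℂ] Y.carrier} (h : IsIsometricIso X Y Φ) : Intertwines X Y Φ := by
  have hiso : ∀ φ ψ : State Y.carrier,
      mkEDist X.L (φ.comp (Φ : X.carrier →⋆ₐ[ℂ] Y.carrier))
        (ψ.comp (Φ : X.carrier →⋆ₐ[ℂ] Y.carrier)) = mkEDist Y.L φ ψ := h.1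
  have hsmul : ∀ (r : ℝ) (a : selfAdjoint X.carrier),
      Y.L (saMap Φ (r • a)) = ENNReal.ofReal |r| * Y.L (saMap Φ a) := fun r a => by
    rw [saMap_smul, Y.isQCMS.smul]
  intro a
  refine le_antisymm ?_ ?_
  · refine le_of_unitBall_subset (L' := fun a => Y.L (saMap Φ a)) X.isQCMS.smul hsmul
      (fun a ha => ?_) a
    refine Y.isQCMS.le_one_of_forall_edist_le hY.lsc fun φ ψ => ?_
    rw [← hiso]
    exact edist_apply_le_mkEDist ha (φ.comp (Φ : X.carrier →⋆ₐ[ℂ] Y.carrier)) _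
  · refine le_of_unitBall_subset (L := fun a => Y.L (saMap Φ a)) hsmul X.isQCMS.smul
      (fun a ha => ?_) a
    refine X.isQCMS.le_one_of_forall_edist_le hX.lsc fun φ ψ => ?_
    obtain ⟨φ, rfl⟩ := h.2 φ
    obtain ⟨ψ, rfl⟩ := h.2 ψ
    refine le_trans ?_ (hiso φ ψ).ge
    exact edist_apply_le_mkEDist ha φ ψ

theorem Intertwines.isIsometricIso {Φ : X.carrier ≃⋆ₐ[ℂ] Y.carrier} (h : Intertwines X Y Φ) :
    IsIsometricIso X Y Φ := by
  refine ⟨fun φ ψ => ?_, comp_surjective Φ⟩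
  refine le_antisymm (iSup₂_le fun a ha => ?_) (iSup₂_le fun b hb => ?_)
  · exact edist_apply_le_mkEDist (a := saMap Φ a) ((h a).trans_le ha) φ ψ
  · have h1 : X.L (saMap Φ.symm b) ≤ 1 := by
      rw [← h]
      exact (congrArg Y.L (saMap_saMap_symm Φ b)).trans_le hb
    have h2 := edist_apply_le_mkEDist h1 (φ.comp (Φ : X.carrier →⋆ₐ[ℂ] Y.carrier))
      (ψ.comp (Φ : X.carrier →⋆ₐ[ℂ] Y.carrier))
    rw [State.comp_apply, State.comp_apply] at h2
    have h3 : (Φ : X.carrier →⋆ₐ[ℂ] Y.carrier) (saMap Φ.symm b : X.carrier) = b :=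
      Φ.apply_symm_apply _
    rwa [h3] at h2

theorem stateDiam_lt_top (X : QuantumCompactMetricSpace.{u}) : X.stateDiam < ∞ := by
  obtain ⟨d, hd⟩ := X.isQCMS.exists_forall_mkEDist_le
  exact (iSup₂_le hd).trans_lt ENNReal.ofReal_lt_top

theorem mkEDist_le_stateDiam (φ ψ : State X.carrier) : mkEDist X.L φ ψ ≤ X.stateDiam :=
  le_iSup₂ (f := fun φ ψ => mkEDist X.L φ ψ) φ ψ

/-- An element of Lip-norm at most `1` is within the diameter of the state space of a scalar. -/
theorem exists_edist_smul_one_le {a : selfAdjoint X.carrier} (ha : X.L a ≤ 1) :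
    ∃ r : ℝ, edist a (r • (1 : selfAdjoint X.carrier)) ≤ X.stateDiam := by
  obtain ⟨φ₀⟩ : Nonempty (State X.carrier) := inferInstance
  refine ⟨(φ₀ a).re, ?_⟩
  rw [edist_dist, dist_eq_norm]
  refine ENNReal.ofReal_le_of_le_toReal
    (State.norm_selfAdjoint_le ENNReal.toReal_nonneg fun φ => ?_)
  rw [State.re_sub, State.re_smul, State.re_one, mul_one,
    ← ENNReal.ofReal_le_iff_le_toReal X.stateDiam_lt_top.ne, ← State.edist_apply]
  exact (edist_apply_le_mkEDist ha φ φ₀).trans (mkEDist_le_stateDiam φ φ₀)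

end QuantumCompactMetricSpace

/-! ### Bridges with pivot 1 and reversed bridges. -/

theorem mem_oneLevel_one {D : Type u} [CStarAlgebra D] (φ : State D) : φ ∈ oneLevel (1 : D) := by
  simp [oneLevel]

theorem oneLevel_star {D : Type u} [CStarAlgebra D] (ω : D) : oneLevel (star ω) = oneLevel ω := by
  ext φ
  have h1 : star (1 - star ω) = 1 - ω := by simp
  have h2 : star (1 - ω) = 1 - star ω := by simp
  change (_ ∧ _) ↔ (_ ∧ _)
  rw [h1, h2]
  exact and_comm

namespace Bridge

variable {X Y : QuantumCompactMetricSpace.{u}}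

/-- Every state of `γ.D` is in the 1-level of 1, and every state of either side extends to `γ.D`. -/
theorem height_eq_zero_of_pivot_eq_one (γ : Bridge X.carrier Y.carrier) (h : γ.pivot = 1) :
    γ.height = 0 := by
  have huniv : oneLevel γ.pivot = Set.univ := Set.eq_univ_of_forall fun φ => h ▸ mem_oneLevel_one φ
  rw [height, huniv, Set.image_univ, Set.image_univ,
    Set.range_eq_univ.mpr fun φ => State.exists_comp_eq γ.left γ.left_injective φ,
    Set.range_eq_univ.mpr fun φ => State.exists_comp_eq γ.right γ.right_injective φ,
    stateHausdorff, stateHausdorff, @Metric.hausdorffEDist_self _ (mkSpace X.L),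
    @Metric.hausdorffEDist_self _ (mkSpace Y.L), max_self]

/-- A bridge read backwards. -/
noncomputable def symm {A B : Type u} [CStarAlgebra A] [CStarAlgebra B] (γ : Bridge A B) :
    Bridge B A where
  D := γ.D
  pivot := star γ.pivot
  left := γ.right
  right := γ.left
  left_injective := γ.right_injective
  right_injective := γ.left_injective
  oneLevel_nonempty := (oneLevel_star γ.pivot).symm ▸ γ.oneLevel_nonempty

theorem height_symm (γ : Bridge X.carrier Y.carrier) :
    height (X := Y) (Y := X) γ.symm = γ.height := by
  change max (Y.stateHausdorff _ ((fun φ => State.comp φ γ.right) '' oneLevel (star γ.pivot)))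
    (X.stateHausdorff _ ((fun φ => State.comp φ γ.left) '' oneLevel (star γ.pivot))) = _
  rw [oneLevel_star, max_comm]
  rfl

/-- The adjoint is an isometry, and on self-adjoint elements it moves the pivot to the other side at
the cost of a star, which is why the reversed pivot is `star γ.pivot`. -/
theorem reach_symm (γ : Bridge X.carrier Y.carrier) :
    reach (X := Y) (Y := X) γ.symm = γ.reach := by
  have hstar : Isometry (star : γ.D → γ.D) := (starₗᵢ ℂ : γ.D ≃ₗᵢ⋆[ℂ] γ.D).isometry
  have h := Metric.hausdorffEDist_image hstar
    (s := (fun b : selfAdjoint Y.carrier => γ.pivot * γ.right b) '' Y.lipBall)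
    (t := (fun a : selfAdjoint X.carrier => γ.left a * γ.pivot) '' X.lipBall)
  rw [Set.image_image, Set.image_image] at h
  rw [reach.eq_def γ, Metric.hausdorffEDist_comm, ← h, reach]
  congr 1
  · refine Set.image_congr fun b _ => ?_
    rw [star_mul, ← map_star, selfAdjoint.star_val_eq]
    rfl
  · refine Set.image_congr fun a _ => ?_
    rw [star_mul, ← map_star, selfAdjoint.star_val_eq]
    rfl

theorem length_symm (γ : Bridge X.carrier Y.carrier) :
    length (X := Y) (Y := X) γ.symm = γ.length := by
  rw [length, length, reach_symm, height_symm]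

end Bridge

/-! ### Concatenation and reversal of treks; symmetry, triangle inequality, upper bounds. -/

namespace Trek

variable {C : Set QuantumCompactMetricSpace.{u}} {X Y Z : QuantumCompactMetricSpace.{u}}

theorem exists_append (Γ : Trek C X Y) (Δ : Trek C Y Z) :
    ∃ Θ : Trek C X Z, Θ.length = Γ.length + Δ.length := by
  induction Γ with
  | single hX hY γ => exact ⟨.cons hX γ Δ, rfl⟩
  | cons hX γ Γ ih =>
    obtain ⟨Θ, hΘ⟩ := ih Δ
    exact ⟨.cons hX γ Θ, by rw [length, hΘ, length, add_assoc]⟩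

theorem left_mem (Γ : Trek C X Y) : X ∈ C := by
  cases Γ <;> assumption

theorem exists_symm (Γ : Trek C X Y) : ∃ Δ : Trek C Y X, Δ.length = Γ.length := by
  induction Γ with
  | single hX hY γ => exact ⟨.single hY hX γ.symm, γ.length_symm⟩
  | cons hX γ Γ ih =>
    obtain ⟨Δ, hΔ⟩ := ih
    obtain ⟨Θ, hΘ⟩ := exists_append Δ (.single Γ.left_mem hX γ.symm)
    refine ⟨Θ, ?_⟩
    rw [hΘ, hΔ, length, length, γ.length_symm, add_comm]

end Trek

section

variable {C : Set QuantumCompactMetricSpace.{u}} {X Y Z : QuantumCompactMetricSpace.{u}}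

theorem propinquity_comm : propinquity C X Y = propinquity C Y X := by
  have key : ∀ X Y, propinquity C X Y ≤ propinquity C Y X := fun X Y =>
    le_iInf fun Γ => by
      obtain ⟨Δ, hΔ⟩ := Γ.exists_symm
      exact hΔ ▸ iInf_le _ Δ
  exact le_antisymm (key X Y) (key Y X)

theorem propinquity_triangle :
    propinquity C X Y ≤ propinquity C X Z + propinquity C Z Y := by
  refine ENNReal.le_iInf_add_iInf fun Γ Δ => ?_
  obtain ⟨Θ, hΘ⟩ := Γ.exists_append Δ
  exact hΘ ▸ iInf_le _ Θ

theorem propinquity_le_length (hX : X ∈ C) (hY : Y ∈ C) (γ : Bridge X.carrier Y.carrier) :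
    propinquity C X Y ≤ γ.length := iInf_le (fun Γ : Trek C X Y => Γ.length) (.single hX hY γ)

theorem propinquity_eq_zero_of_intertwines (hX : X ∈ C) (hY : Y ∈ C)
    {Φ : X.carrier ≃⋆ₐ[ℂ] Y.carrier} (h : Intertwines X Y Φ) : propinquity C X Y = 0 := by
  let γ : Bridge X.carrier Y.carrier :=
    { D := Y.carrier
      pivot := 1
      left := (Φ : X.carrier →⋆ₐ[ℂ] Y.carrier)
      right := StarAlgHom.id ℂ Y.carrier
      left_injective := Φ.injective
      right_injective := Function.injective_id
      oneLevel_nonempty := by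
        obtain ⟨φ₀⟩ : Nonempty (State Y.carrier) := inferInstance
        exact ⟨φ₀, mem_oneLevel_one φ₀⟩ }
  refine le_antisymm ((propinquity_le_length hX hY γ).trans_eq ?_) zero_le
  have hreach : γ.reach = 0 := by
    rw [Bridge.reach]
    have : (fun a : selfAdjoint X.carrier => γ.left a * γ.pivot) '' X.lipBall =
        (fun b : selfAdjoint Y.carrier => γ.pivot * γ.right b) '' Y.lipBall := by
      ext y
      constructor
      · rintro ⟨a, ha, rfl⟩
        exact ⟨saMap Φ a, (h a).trans_le ha, (one_mul (Φ a)).trans (mul_one (Φ a)).symm⟩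
      · rintro ⟨b, hb, rfl⟩
        refine ⟨saMap Φ.symm b, ?_, ?_⟩
        · change X.L _ ≤ 1
          rw [← h]
          exact (congrArg Y.L (saMap_saMap_symm Φ b)).trans_le hb
        · refine (mul_one (Φ (Φ.symm b))).trans ?_
          rw [Φ.apply_symm_apply]
          exact (one_mul (b : Y.carrier)).symm
    rw [this, Metric.hausdorffEDist_self]
  rw [Bridge.length, hreach, γ.height_eq_zero_of_pivot_eq_one rfl, max_self]

/-- The propinquity is bounded by the diameters when the two C*-algebras embed in a common one. -/
theorem propinquity_le_max_stateDiam (hX : X ∈ C) (hY : Y ∈ C) {D : Type u} [CStarAlgebra D]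
    {f : X.carrier →⋆ₐ[ℂ] D} {g : Y.carrier →⋆ₐ[ℂ] D} (hf : Function.Injective f)
    (hg : Function.Injective g) : propinquity C X Y ≤ max X.stateDiam Y.stateDiam := by
  have : Nontrivial D := hf.nontrivial
  let γ : Bridge X.carrier Y.carrier :=
    { D := D
      pivot := 1
      left := f
      right := g
      left_injective := hf
      right_injective := hg
      oneLevel_nonempty := by
        obtain ⟨φ₀⟩ : Nonempty (State D) := inferInstance
        exact ⟨φ₀, mem_oneLevel_one φ₀⟩ }
  refine (propinquity_le_length hX hY γ).trans ?_
  rw [Bridge.length, γ.height_eq_zero_of_pivot_eq_one rfl, max_eq_left zero_le]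
  refine Metric.hausdorffEDist_le_of_mem_edist ?_ ?_
  · rintro _ ⟨a, ha, rfl⟩
    obtain ⟨r, hr⟩ := exists_edist_smul_one_le ha
    -- The scalar near `a` is also a scalar of `Y`, and both embeddings send it to the same element
    -- of `D`.
    refine ⟨_, ⟨r • 1, (Y.isQCMS.map_smul_one r).trans_le zero_le, rfl⟩, le_max_of_le_left ?_⟩
    refine le_trans (le_of_eq ?_) hr
    change edist (f a * 1) (1 * g ((r • 1 : selfAdjoint Y.carrier) : Y.carrier)) = _
    have h1 : g ((r • 1 : selfAdjoint Y.carrier) : Y.carrier) =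
        f ((r • 1 : selfAdjoint X.carrier) : X.carrier) := by
      rw [selfAdjoint.val_smul, selfAdjoint.val_smul, selfAdjoint.val_one, selfAdjoint.val_one,
        ← Complex.coe_smul, ← Complex.coe_smul, map_smul, map_smul, map_one, map_one]
    rw [mul_one, one_mul, h1, (NonUnitalStarAlgHom.isometry f hf).edist_eq]
    rfl
  · rintro _ ⟨b, hb, rfl⟩
    obtain ⟨r, hr⟩ := exists_edist_smul_one_le hb
    refine ⟨_, ⟨r • 1, (X.isQCMS.map_smul_one r).trans_le zero_le, rfl⟩, le_max_of_le_right ?_⟩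
    refine le_trans (le_of_eq ?_) hr
    change edist (1 * g b) (f ((r • 1 : selfAdjoint X.carrier) : X.carrier) * 1) = _
    have h1 : f ((r • 1 : selfAdjoint X.carrier) : X.carrier) =
        g ((r • 1 : selfAdjoint Y.carrier) : Y.carrier) := by
      rw [selfAdjoint.val_smul, selfAdjoint.val_smul, selfAdjoint.val_one, selfAdjoint.val_one,
        ← Complex.coe_smul, ← Complex.coe_smul, map_smul, map_smul, map_one, map_one]
    rw [mul_one, one_mul, h1, (NonUnitalStarAlgHom.isometry g hg).edist_eq]
    rfl

end

/-! ### Faithful representations and a common unital embedding. -/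

section Representations

variable {A : Type u} [CStarAlgebra A]

/-- The Hilbert sum of a family of representations. -/
noncomputable def sumRep {ι : Type u} {H : ι → Type u} [∀ i, NormedAddCommGroup (H i)]
    [∀ i, InnerProductSpace ℂ (H i)] [∀ i, CompleteSpace (H i)]
    (π : ∀ i, A →⋆ₐ[ℂ] (H i →L[ℂ] H i)) : A →⋆ₐ[ℂ] (lp H 2 →L[ℂ] lp H 2) where
  toFun a := lp.mapCLM 2 (fun i => π i a) (norm_nonneg a)
    fun i => NonUnitalStarAlgHom.norm_apply_le (π i) a
  map_one' := by ext x i; simp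
  map_mul' a b := by ext x i; simp
  map_zero' := by ext x i; simp
  map_add' a b := by ext x i; simp
  commutes' r := by ext x i; simp [Algebra.algebraMap_eq_smul_one]
  map_star' a := by
    rw [ContinuousLinearMap.star_eq_adjoint, ContinuousLinearMap.eq_adjoint_iff]
    intro x y
    rw [lp.inner_eq_tsum, lp.inner_eq_tsum]
    refine tsum_congr fun i => ?_
    rw [lp.mapCLM_apply_coe, lp.mapCLM_apply_coe, map_star, ContinuousLinearMap.star_eq_adjoint,
      ContinuousLinearMap.adjoint_inner_left]

theorem sumRep_apply {ι : Type u} {H : ι → Type u} [∀ i, NormedAddCommGroup (H i)]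
    [∀ i, InnerProductSpace ℂ (H i)] [∀ i, CompleteSpace (H i)]
    (π : ∀ i, A →⋆ₐ[ℂ] (H i →L[ℂ] H i)) (a : A) (x : lp H 2) (i : ι) :
    sumRep π a x i = π i a (x i) := rfl

theorem eq_zero_of_sumRep_eq_zero {ι : Type u} {H : ι → Type u} [∀ i, NormedAddCommGroup (H i)]
    [∀ i, InnerProductSpace ℂ (H i)] [∀ i, CompleteSpace (H i)]
    {π : ∀ i, A →⋆ₐ[ℂ] (H i →L[ℂ] H i)} {a : A} (h : sumRep π a = 0) (i : ι) : π i a = 0 := by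
  classical
  ext x
  have h1 := sumRep_apply π a (lp.single 2 i x) i
  rw [h, lp.single_apply_self] at h1
  exact h1.symm

variable (A) in
/-- Every unital C*-algebra has a faithful representation on a Hilbert space. -/
theorem exists_faithful_rep : ∃ (H : Type u) (_ : NormedAddCommGroup H)
    (_ : InnerProductSpace ℂ H) (_ : CompleteSpace H) (π : A →⋆ₐ[ℂ] (H →L[ℂ] H)),
    Function.Injective π := by
  let _ := CStarAlgebra.spectralOrder A
  let _ := CStarAlgebra.spectralOrderedRing A
  let π : ∀ φ : State A, A →⋆ₐ[ℂ]
      (φ.toPositiveLinearMap.GNS →L[ℂ] φ.toPositiveLinearMap.GNS) :=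
    fun φ => φ.toPositiveLinearMap.gnsStarAlgHom
  refine ⟨lp (fun φ : State A => φ.toPositiveLinearMap.GNS) 2, inferInstance, inferInstance,
    inferInstance, sumRep π, ?_⟩
  rw [injective_iff_map_eq_zero]
  intro a ha
  -- The GNS representation of `φ` sends the class of 1 to the class of `a`, whose squared norm is
  -- `φ (star a * a)`.
  have key : ∀ φ : State A, φ (star a * a) = 0 := fun φ => by
    have h1 : π φ a = 0 := eq_zero_of_sumRep_eq_zero ha φ
    let f := φ.toPositiveLinearMap
    have h2 : ((f.toPreGNS a : f.PreGNS) : f.GNS) = 0 := by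
      have h3 := congrArg (fun T => T ((f.toPreGNS 1 : f.PreGNS) : f.GNS)) h1
      have h4 : π φ a ((f.toPreGNS 1 : f.PreGNS) : f.GNS) =
          ((f.toPreGNS a : f.PreGNS) : f.GNS) := by
        refine (f.gnsNonUnitalStarAlgHom_apply_coe).trans ?_
        simp
      exact h4.symm.trans h3
    have h5 : ‖f.toPreGNS a‖ = 0 := by
      rw [← UniformSpace.Completion.norm_coe, h2, norm_zero]
    have h6 := f.preGNS_norm_sq (f.toPreGNS a)
    rw [h5] at h6
    have h7 : f (star a * a) = 0 := by simpa using h6.symm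
    exact h7
  have h0 : ‖star a * a‖ ≤ 0 :=
    State.norm_le_of_forall (IsSelfAdjoint.star_mul_self a) le_rfl fun φ => by rw [key, norm_zero]
  rw [CStarRing.norm_star_mul_self] at h0
  have := norm_nonneg a
  exact norm_eq_zero.mp (by nlinarith)

end Representations

/-- The Hilbert basis of a multiple of a Hilbert space. -/
theorem exists_hilbertBasis_lp {H : Type u} [NormedAddCommGroup H] [InnerProductSpace ℂ H]
    [CompleteSpace H] {I J κ : Type u} (b : HilbertBasis J ℂ H) (e : κ ≃ I × J) :
    Nonempty (HilbertBasis κ ℂ (lp (fun _ : I => H) 2)) := by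
  classical
  let v : κ → lp (fun _ : I => H) 2 := fun k => lp.single 2 (e k).1 (b (e k).2)
  have hv : Orthonormal ℂ v := by
    rw [orthonormal_iff_ite]
    intro k l
    rw [lp.inner_single_left]
    by_cases h1 : (e k).1 = (e l).1
    · have h2 : (v l : I → H) (e k).1 = b (e l).2 := by
        rw [h1]; exact lp.single_apply_self 2 _ _
      rw [h2, orthonormal_iff_ite.mp b.orthonormal]
      by_cases h3 : k = l
      · rw [if_pos h3, h3, if_pos rfl]
      · rw [if_neg h3, if_neg fun h => h3 (e.injective (Prod.ext h1 h))]
    · have h2 : (v l : I → H) (e k).1 = 0 := lp.single_apply_ne 2 _ _ h1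
      rw [h2, inner_zero_right, if_neg fun h => h1 (by rw [h])]
  refine ⟨HilbertBasis.mkOfOrthogonalEqBot hv ?_⟩
  rw [Submodule.eq_bot_iff]
  intro x hx
  rw [Submodule.mem_orthogonal] at hx
  ext i : 2
  have h0 : b.repr (x i) = 0 := by
    ext j
    rw [b.repr_apply_apply, ← lp.inner_single_left (𝕜 := ℂ) i (b j) x]
    refine hx _ (Submodule.subset_span ⟨e.symm (i, j), ?_⟩)
    simp [v]
  exact (LinearIsometryEquiv.map_eq_zero_iff b.repr).mp h0

theorem nonempty_of_hilbertBasis {H : Type u} [NormedAddCommGroup H] [InnerProductSpace ℂ H]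
    [CompleteSpace H] {J : Type u} (b : HilbertBasis J ℂ H) [Nontrivial (H →L[ℂ] H)] :
    Nonempty J := by
  by_contra hJ
  rw [not_nonempty_iff] at hJ
  obtain ⟨S, T, hST⟩ := exists_pair_ne (H →L[ℂ] H)
  refine hST (ContinuousLinearMap.ext fun x => b.repr.injective ?_)
  ext j
  exact hJ.elim j

/-- Any two nonzero unital C*-algebras embed unitally in a common one. -/
theorem exists_common_embedding (A B : Type u) [CStarAlgebra A] [CStarAlgebra B] [Nontrivial A]
    [Nontrivial B] :
    ∃ (D : Type u) (_ : CStarAlgebra D) (f : A →⋆ₐ[ℂ] D) (g : B →⋆ₐ[ℂ] D),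
      Function.Injective f ∧ Function.Injective g := by
  obtain ⟨H, _, _, _, π, hπ⟩ := exists_faithful_rep A
  obtain ⟨K, _, _, _, ρ, hρ⟩ := exists_faithful_rep B
  obtain ⟨I, b, -⟩ := exists_hilbertBasis ℂ H
  obtain ⟨J, c, -⟩ := exists_hilbertBasis ℂ K
  have : Nontrivial (H →L[ℂ] H) := hπ.nontrivial
  have : Nontrivial (K →L[ℂ] K) := hρ.nontrivial
  -- Nonempty index sets are needed: an empty multiple of a representation is not faithful.
  obtain ⟨i⟩ := nonempty_of_hilbertBasis b
  obtain ⟨j⟩ := nonempty_of_hilbertBasis c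
  -- `J` copies of `H` and `I` copies of `K` both have bases indexed by `J × I`, hence are unitarily
  -- equivalent.
  obtain ⟨b'⟩ := exists_hilbertBasis_lp (I := J) b (Equiv.refl _)
  obtain ⟨c'⟩ := exists_hilbertBasis_lp (I := I) c (Equiv.prodComm J I)
  let U := c'.repr.trans b'.repr.symm
  let V := U.conjStarAlgEquiv
  refine ⟨lp (fun _ : J => H) 2 →L[ℂ] lp (fun _ : J => H) 2, inferInstance,
    sumRep fun _ => π, StarAlgHom.comp V.toStarAlgHom (sumRep fun _ => ρ), ?_, ?_⟩
  · rw [injective_iff_map_eq_zero]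
    intro x hx
    exact (map_eq_zero_iff π hπ).mp (eq_zero_of_sumRep_eq_zero hx j)
  · rw [injective_iff_map_eq_zero]
    intro x hx
    have h1 : sumRep (fun _ : I => ρ) x = 0 := (map_eq_zero_iff V V.injective).mp hx
    exact (map_eq_zero_iff ρ hρ).mp (eq_zero_of_sumRep_eq_zero h1 i)

/-! ### From Lie–Jordan relations to *-isomorphisms. -/

section Graph

variable {A B : Type u} [CStarAlgebra A] [CStarAlgebra B]

/-- This upgrades compatibility with the two self-adjoint products to multiplicativity. -/
theorem mul_eq_jordan_add_lie (a b : selfAdjoint A) :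
    (a : A) * b = (jordan a b : A) + Complex.I • (lie a b : A) := by
  have h : Complex.I * (1 / (2 * Complex.I)) = (1 / 2 : ℂ) := by
    field_simp
  change (a : A) * b = (1 / 2 : ℂ) • ((a : A) * b + b * a) +
    Complex.I • (1 / (2 * Complex.I) : ℂ) • ((a : A) * b - b * a)
  rw [smul_smul, h, ← smul_add, add_add_sub_cancel, ← two_smul ℂ, smul_smul]
  norm_num

/-- A real linear relation between the self-adjoint parts of two C*-algebras that is compatible with
the units and with the Jordan and Lie products, preserves the norm, and has dense domain and
range. -/
structure IsLieJordanRelation (G : selfAdjoint A → selfAdjoint B → Prop) : Prop where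
  add : ∀ {a a' b b'}, G a b → G a' b' → G (a + a') (b + b')
  smul : ∀ (r : ℝ) {a b}, G a b → G (r • a) (r • b)
  one : G 1 1
  jordan : ∀ {a a' b b'}, G a b → G a' b' → G (jordan a a') (jordan b b')
  lie : ∀ {a a' b b'}, G a b → G a' b' → G (lie a a') (lie b b')
  norm_eq : ∀ {a b}, G a b → ‖a‖ = ‖b‖
  dense_left : Dense {a | ∃ b, G a b}
  dense_right : Dense {b | ∃ a, G a b}

namespace IsLieJordanRelation

variable {G : selfAdjoint A → selfAdjoint B → Prop} (hG : IsLieJordanRelation G)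
include hG

theorem zero : G 0 0 := by simpa using hG.smul 0 hG.one

theorem sub {a a' b b'} (h : G a b) (h' : G a' b') : G (a - a') (b - b') := by
  simpa [sub_eq_add_neg] using hG.add h (hG.smul (-1) h')

/-- The *-subalgebra of the product generated by the graph of a Lie-Jordan relation. -/
def starSubalgebra : StarSubalgebra ℂ (A × B) where
  carrier := {p | ∃ a a' b b', G a b ∧ G a' b' ∧
    p = ((a : A) + Complex.I • (a' : A), (b : B) + Complex.I • (b' : B))}
  mul_mem' := by
    rintro _ _ ⟨x, y, x', y', h1, h2, rfl⟩ ⟨z, w, z', w', h3, h4, rfl⟩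
    refine ⟨_, _, _, _,
      hG.sub (hG.sub (hG.jordan h1 h3) (hG.jordan h2 h4)) (hG.add (hG.lie h1 h4) (hG.lie h2 h3)),
      hG.add (hG.sub (hG.lie h1 h3) (hG.lie h2 h4))
        (hG.add (hG.jordan h1 h4) (hG.jordan h2 h3)), ?_⟩
    have key : ∀ {E : Type u} [CStarAlgebra E] (x y z w : selfAdjoint E),
        ((x : E) + Complex.I • (y : E)) * ((z : E) + Complex.I • (w : E)) =
        ((Propinquity.jordan x z - Propinquity.jordan y w -
          (Propinquity.lie x w + Propinquity.lie y z) : selfAdjoint E) : E) +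
        Complex.I • ((Propinquity.lie x z - Propinquity.lie y w +
          (Propinquity.jordan x w + Propinquity.jordan y z) : selfAdjoint E) : E) := by
      intro E _ x y z w
      have hI : ∀ e : E, Complex.I • Complex.I • e = -e := fun e => by
        rw [smul_smul, Complex.I_mul_I, neg_one_smul]
      simp only [mul_add, add_mul, smul_mul_assoc, mul_smul_comm, mul_eq_jordan_add_lie,
        AddSubgroup.coe_add, AddSubgroup.coe_sub, smul_add, smul_sub, smul_neg, hI]
      abel
    exact Prod.ext (key x y z w) (key x' y' z' w')
  add_mem' := by
    rintro _ _ ⟨x, y, x', y', h1, h2, rfl⟩ ⟨z, w, z', w', h3, h4, rfl⟩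
    refine ⟨_, _, _, _, hG.add h1 h3, hG.add h2 h4, Prod.ext ?_ ?_⟩
    · simp only [Prod.mk_add_mk, AddSubgroup.coe_add, smul_add]
      abel
    · simp only [Prod.mk_add_mk, AddSubgroup.coe_add, smul_add]
      abel
  algebraMap_mem' c := by
    refine ⟨_, _, _, _, hG.smul c.re hG.one, hG.smul c.im hG.one, ?_⟩
    have key : ∀ {E : Type u} [CStarAlgebra E], algebraMap ℂ E c =
        ((c.re • (1 : selfAdjoint E) : selfAdjoint E) : E) +
          Complex.I • ((c.im • (1 : selfAdjoint E) : selfAdjoint E) : E) := by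
      intro E _
      rw [selfAdjoint.val_smul, selfAdjoint.val_smul, selfAdjoint.val_one, ← Complex.coe_smul,
        ← Complex.coe_smul, smul_smul, ← add_smul, Algebra.algebraMap_eq_smul_one, mul_comm,
        Complex.re_add_im]
    exact Prod.ext key key
  star_mem' := by
    rintro _ ⟨x, y, x', y', h1, h2, rfl⟩
    refine ⟨_, _, _, _, h1, hG.smul (-1) h2, Prod.ext ?_ ?_⟩ <;> simp

theorem mem_starSubalgebra {a b} (h : G a b) : ((a : A), (b : B)) ∈ hG.starSubalgebra :=
  ⟨a, 0, b, 0, h, hG.zero, by simp⟩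

/-- The element `star p * p` is again in the subalgebra and is self-adjoint, so its components equal
their real parts, which form a `G`-related pair; the C*-identity transfers the equality of norms to
`p`. -/
theorem norm_fst_eq_norm_snd {p : A × B} (hp : p ∈ hG.starSubalgebra) : ‖p.1‖ = ‖p.2‖ := by
  obtain ⟨x, y, x', y', h1, h2, h3⟩ := mul_mem (star_mem hp) hp
  have key : ∀ {E : Type u} [CStarAlgebra E] (e : E) (x y : selfAdjoint E),
      star e * e = (x : E) + Complex.I • (y : E) → (x : E) = star e * e := by
    intro E _ e x y h
    have h4 : realPart (star e * e) = x := by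
      rw [h, map_add, realPart_I_smul, selfAdjoint.realPart_coe, selfAdjoint.imaginaryPart_coe,
        neg_zero, add_zero]
    rw [← h4]
    exact (IsSelfAdjoint.star_mul_self e).coe_realPart
  have e1 := key p.1 x y (congrArg Prod.fst h3)
  have e2 := key p.2 x' y' (congrArg Prod.snd h3)
  have e3 : ‖(x : A)‖ = ‖(x' : B)‖ := hG.norm_eq h1
  rw [e1, e2, CStarRing.norm_star_mul_self, CStarRing.norm_star_mul_self] at e3
  exact (mul_self_inj (norm_nonneg _) (norm_nonneg _)).mp e3

theorem norm_fst_eq_norm_snd' {p : A × B} (hp : p ∈ hG.starSubalgebra.topologicalClosure) :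
    ‖p.1‖ = ‖p.2‖ := by
  have hc : IsClosed {p : A × B | ‖p.1‖ = ‖p.2‖} :=
    isClosed_eq (by fun_prop) (by fun_prop)
  have hsub : (hG.starSubalgebra : Set (A × B)) ⊆ {p : A × B | ‖p.1‖ = ‖p.2‖} :=
    fun p hp => hG.norm_fst_eq_norm_snd hp
  exact closure_minimal hsub hc hp

/-- On the closed graph both coordinate projections are isometric, so their ranges are closed; these
are also dense, so both projections are *-isomorphisms, and `Φ` is the second after the inverse of
the first. -/
theorem exists_starAlgEquiv : ∃ Φ : A ≃⋆ₐ[ℂ] B, ∀ a b, G a b → Φ a = b := by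
  let D := hG.starSubalgebra.topologicalClosure
  have : CompleteSpace D := (hG.starSubalgebra.isClosed_topologicalClosure).completeSpace_coe
  let p : D →⋆ₐ[ℂ] A := (StarAlgHom.fst ℂ A B).comp D.subtype
  let q : D →⋆ₐ[ℂ] B := (StarAlgHom.snd ℂ A B).comp D.subtype
  have hpq : ∀ d : D, ‖p d‖ = ‖q d‖ := fun d => hG.norm_fst_eq_norm_snd' d.2
  have hdn : ∀ d : D, ‖d‖ = max ‖p d‖ ‖q d‖ := fun d => rfl
  have hp : Isometry p := AddMonoidHomClass.isometry_of_norm p fun d => by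
    rw [hdn, ← hpq, max_self]
  have hq : Isometry q := AddMonoidHomClass.isometry_of_norm q fun d => by
    rw [hdn, hpq, max_self]
  have hdense : ∀ {E : Type u} [CStarAlgebra E] {s : Set (selfAdjoint E)}, Dense s →
      Dense ((fun z : selfAdjoint E × selfAdjoint E => (z.1 : E) + Complex.I • (z.2 : E)) ''
        s ×ˢ s) := by
    intro E _ s hs
    refine DenseRange.dense_image ?_ (by fun_prop) (hs.prod hs)
    exact Function.Surjective.denseRange fun e =>
      ⟨(realPart e, imaginaryPart e), realPart_add_I_smul_imaginaryPart e⟩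
  have hps : Function.Surjective p := by
    rw [← Set.range_eq_univ, ← hp.isClosedEmbedding.isClosed_range.closure_eq]
    refine ((hdense hG.dense_left).mono ?_).closure_eq
    rintro _ ⟨⟨x, y⟩, ⟨⟨x', hx⟩, ⟨y', hy⟩⟩, rfl⟩
    exact ⟨⟨_, hG.starSubalgebra.le_topologicalClosure ⟨x, y, x', y', hx, hy, rfl⟩⟩, rfl⟩
  have hqs : Function.Surjective q := by
    rw [← Set.range_eq_univ, ← hq.isClosedEmbedding.isClosed_range.closure_eq]
    refine ((hdense hG.dense_right).mono ?_).closure_eq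
    rintro _ ⟨⟨x', y'⟩, ⟨⟨x, hx⟩, ⟨y, hy⟩⟩, rfl⟩
    exact ⟨⟨_, hG.starSubalgebra.le_topologicalClosure ⟨x, y, x', y', hx, hy, rfl⟩⟩, rfl⟩
  let P := StarAlgEquiv.ofBijective p ⟨hp.injective, hps⟩
  let Q := StarAlgEquiv.ofBijective q ⟨hq.injective, hqs⟩
  refine ⟨P.symm.trans Q, fun a b hab => ?_⟩
  let d : D := ⟨((a : A), (b : B)),
    hG.starSubalgebra.le_topologicalClosure (hG.mem_starSubalgebra hab)⟩
  have h1 : P.symm (P d) = d := P.symm_apply_apply d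
  have h2 : P d = a := rfl
  rw [h2] at h1
  change Q (P.symm a) = b
  rw [h1]
  rfl

end IsLieJordanRelation

end Graph

/-! ### Approximate correspondences and their composition. -/

/-- A scale-indexed relation between self-adjoint elements that is, up to an error of size `lam`
proportional to the scale, an isomorphism of Leibniz quantum compact metric spaces. -/
structure IsApproxCorrespondence (X Y : QuantumCompactMetricSpace.{u}) (lam : ℝ)
    (T : ℝ → selfAdjoint X.carrier → selfAdjoint Y.carrier → Prop) : Prop where
  lam_nonneg : 0 ≤ lam
  pos : ∀ {r a b}, T r a b → 0 < r
  left_le : ∀ {r a b}, T r a b → X.L a ≤ ENNReal.ofReal r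
  right_le : ∀ {r a b}, T r a b → Y.L b ≤ ENNReal.ofReal r
  exists_right : ∀ {r a}, 0 < r → X.L a ≤ ENNReal.ofReal r → ∃ b, T r a b
  exists_left : ∀ {r b}, 0 < r → Y.L b ≤ ENNReal.ofReal r → ∃ a, T r a b
  one : ∀ {r}, 0 < r → T r 1 1
  add : ∀ {r r' a a' b b'}, T r a b → T r' a' b' → T (r + r') (a + a') (b + b')
  -- The target scale is not tied to `|t| * r`, which may be 0 while scales are positive.
  smul : ∀ {r r' a b} (t : ℝ), T r a b → 0 < r' → |t| * r ≤ r' → T r' (t • a) (t • b)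
  norm_right : ∀ {r a b}, T r a b → ‖b‖ ≤ ‖a‖ + 2 * r * lam
  norm_left : ∀ {r a b}, T r a b → ‖a‖ ≤ ‖b‖ + 2 * r * lam
  -- By `norm_right`, `K` bounds the norms on both sides; the Leibniz rule then dictates the scale
  -- `K * (r + r')`.
  jordan : ∀ {r r' a a' b b' K}, T r a b → T r' a' b' → 0 < K → ‖a‖ + 2 * r * lam ≤ K →
    ‖a'‖ + 2 * r' * lam ≤ K → T (K * (r + r')) (jordan a a') (jordan b b')
  lie : ∀ {r r' a a' b b' K}, T r a b → T r' a' b' → 0 < K → ‖a‖ + 2 * r * lam ≤ K →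
    ‖a'‖ + 2 * r' * lam ≤ K → T (K * (r + r')) (lie a a') (lie b b')

namespace IsApproxCorrespondence

variable {X Y Z : QuantumCompactMetricSpace.{u}} {lam lam' : ℝ}
  {T : ℝ → selfAdjoint X.carrier → selfAdjoint Y.carrier → Prop}
  {T' : ℝ → selfAdjoint Y.carrier → selfAdjoint Z.carrier → Prop}

theorem sub (hT : IsApproxCorrespondence X Y lam T) {r r' a a' b b'} (h : T r a b)
    (h' : T r' a' b') : T (r + r') (a - a') (b - b') := by
  simpa [sub_eq_add_neg] using hT.add h (hT.smul (-1) h' (hT.pos h') (by simp))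

/-- The intermediate element has norm at most `‖a‖ + 2 * r * lam`, so a `K` admissible for the
summed error is admissible for each factor. -/
theorem comp (hT : IsApproxCorrespondence X Y lam T) (hT' : IsApproxCorrespondence Y Z lam' T') :
    IsApproxCorrespondence X Z (lam + lam') fun r a c => ∃ b, T r a b ∧ T' r b c where
  lam_nonneg := add_nonneg hT.lam_nonneg hT'.lam_nonneg
  pos := fun ⟨_, h, _⟩ => hT.pos h
  left_le := fun ⟨_, h, _⟩ => hT.left_le h
  right_le := fun ⟨_, _, h⟩ => hT'.right_le h
  exists_right := fun hr ha => by
    obtain ⟨b, hb⟩ := hT.exists_right hr ha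
    obtain ⟨c, hc⟩ := hT'.exists_right hr (hT.right_le hb)
    exact ⟨c, b, hb, hc⟩
  exists_left := fun hr hc => by
    obtain ⟨b, hb⟩ := hT'.exists_left hr hc
    obtain ⟨a, ha⟩ := hT.exists_left hr (hT'.left_le hb)
    exact ⟨a, b, ha, hb⟩
  one := fun hr => ⟨1, hT.one hr, hT'.one hr⟩
  add := fun ⟨_, h1, h2⟩ ⟨_, h3, h4⟩ => ⟨_, hT.add h1 h3, hT'.add h2 h4⟩
  smul := fun t ⟨_, h1, h2⟩ hr h => ⟨_, hT.smul t h1 hr h, hT'.smul t h2 hr h⟩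
  norm_right := fun ⟨_, h1, h2⟩ => by linarith [hT.norm_right h1, hT'.norm_right h2]
  norm_left := fun ⟨_, h1, h2⟩ => by linarith [hT.norm_left h1, hT'.norm_left h2]
  jordan := fun {r r' _ _ _ _ _} ⟨_, h1, h2⟩ ⟨_, h3, h4⟩ hK hr hr' => by
    have e1 : 0 ≤ r * lam' := mul_nonneg (hT.pos h1).le hT'.lam_nonneg
    have e2 : 0 ≤ r' * lam' := mul_nonneg (hT.pos h3).le hT'.lam_nonneg
    exact ⟨_, hT.jordan h1 h3 hK (by linarith) (by linarith),
      hT'.jordan h2 h4 hK (by linarith [hT.norm_right h1]) (by linarith [hT.norm_right h3])⟩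
  lie := fun {r r' _ _ _ _ _} ⟨_, h1, h2⟩ ⟨_, h3, h4⟩ hK hr hr' => by
    have e1 : 0 ≤ r * lam' := mul_nonneg (hT.pos h1).le hT'.lam_nonneg
    have e2 : 0 ≤ r' * lam' := mul_nonneg (hT.pos h3).le hT'.lam_nonneg
    exact ⟨_, hT.lie h1 h3 hK (by linarith) (by linarith),
      hT'.lie h2 h4 hK (by linarith [hT.norm_right h1]) (by linarith [hT.norm_right h3])⟩

end IsApproxCorrespondence

theorem IsLipschitzPair.exists_smul_eq {A : Type u} [CStarAlgebra A] {L : selfAdjoint A → ℝ≥0∞}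
    (hL : IsLipschitzPair L) {a : selfAdjoint A} {r : ℝ} (hr : 0 < r)
    (ha : L a ≤ ENNReal.ofReal r) : ∃ a₀, L a₀ ≤ 1 ∧ a = r • a₀ := by
  refine ⟨r⁻¹ • a, ?_, (smul_inv_smul₀ hr.ne' a).symm⟩
  rw [hL.smul, abs_of_pos (inv_pos.mpr hr)]
  refine (mul_le_mul_right ha _).trans ?_
  rw [← ENNReal.ofReal_mul (inv_nonneg.mpr hr.le), inv_mul_cancel₀ hr.ne', ENNReal.ofReal_one]

theorem IsLipschitzPair.smul_le {A : Type u} [CStarAlgebra A] {L : selfAdjoint A → ℝ≥0∞}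
    (hL : IsLipschitzPair L) {a : selfAdjoint A} {r r' : ℝ} (ha : L a ≤ ENNReal.ofReal r) {t : ℝ}
    (h : |t| * r ≤ r') : L (t • a) ≤ ENNReal.ofReal r' := by
  rw [hL.smul]
  refine (mul_le_mul_right ha _).trans ?_
  rw [← ENNReal.ofReal_mul (abs_nonneg t)]
  exact ENNReal.ofReal_le_ofReal h

theorem IsLipschitzPair.abs_re_sub_le {A : Type u} [CStarAlgebra A]
    {L : selfAdjoint A → ℝ≥0∞} (hL : IsLipschitzPair L) {a : selfAdjoint A} {r lam : ℝ} (hr : 0 < r)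
    (ha : L a ≤ ENNReal.ofReal r) {φ ψ : State A} (h0 : 0 ≤ lam)
    (h : mkEDist L φ ψ < ENNReal.ofReal lam) : |(φ a).re - (ψ a).re| ≤ r * lam := by
  have h1 := (hL.edist_apply_le hr ha φ ψ).trans (mul_le_mul_right h.le _)
  rw [State.edist_apply, ← ENNReal.ofReal_mul hr.le] at h1
  exact (ENNReal.ofReal_le_ofReal_iff (by positivity)).mp h1

theorem leibniz_bound {A : Type u} [CStarAlgebra A] {L : selfAdjoint A → ℝ≥0∞}
    {a a' : selfAdjoint A} {r r' K : ℝ} (hr : 0 < r) (hr' : 0 < r') (hK : 0 < K)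
    (ha : L a ≤ ENNReal.ofReal r) (ha' : L a' ≤ ENNReal.ofReal r') (hn : ‖a‖ ≤ K)
    (hn' : ‖a'‖ ≤ K) :
    ENNReal.ofReal ‖(a : A)‖ * L a' + ENNReal.ofReal ‖(a' : A)‖ * L a ≤
      ENNReal.ofReal (K * (r + r')) := by
  calc _ ≤ ENNReal.ofReal K * ENNReal.ofReal r' + ENNReal.ofReal K * ENNReal.ofReal r := by
        gcongr
        · exact hn
        · exact hn'
    _ = _ := by
        rw [← ENNReal.ofReal_mul hK.le, ← ENNReal.ofReal_mul hK.le,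
          ← ENNReal.ofReal_add (by positivity) (by positivity)]
        congr 1
        ring

/-! ### Short bridges give approximate correspondences. -/

namespace Bridge

variable {X Y : QuantumCompactMetricSpace.{u}}

/-- The pairs of self-adjoint elements of Lip-norm at most `r` that a bridge identifies up to
`r * lam`. -/
def Near (γ : Bridge X.carrier Y.carrier) (lam r : ℝ) (a : selfAdjoint X.carrier)
    (b : selfAdjoint Y.carrier) : Prop :=
  0 < r ∧ X.L a ≤ ENNReal.ofReal r ∧ Y.L b ≤ ENNReal.ofReal r ∧
    ‖γ.left a * γ.pivot - γ.pivot * γ.right b‖ ≤ r * lam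

variable {γ : Bridge X.carrier Y.carrier} {lam : ℝ}

theorem near_smul_of_edist_lt {a : selfAdjoint X.carrier} {b : selfAdjoint Y.carrier}
    (ha : X.L a ≤ 1) (hb : Y.L b ≤ 1) {r : ℝ} (hr : 0 < r)
    (h : edist (γ.left a * γ.pivot) (γ.pivot * γ.right b) < ENNReal.ofReal lam) :
    γ.Near lam r (r • a) (r • b) := by
  have h1 : ∀ x : ℝ≥0∞, x ≤ 1 → ENNReal.ofReal |r| * x ≤ ENNReal.ofReal r := fun x hx => by
    rw [abs_of_pos hr]
    exact mul_le_of_le_one_right' hx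
  refine ⟨hr, ?_, ?_, ?_⟩
  · rw [X.isQCMS.smul]; exact h1 _ ha
  · rw [Y.isQCMS.smul]; exact h1 _ hb
  · rw [edist_dist, dist_eq_norm] at h
    have h2 := (ENNReal.ofReal_lt_ofReal_iff_of_nonneg (norm_nonneg _)).mp h
    rw [selfAdjoint.val_smul, selfAdjoint.val_smul, ← Complex.coe_smul, ← Complex.coe_smul,
      map_smul, map_smul, smul_mul_assoc, mul_smul_comm, ← smul_sub, norm_smul, Complex.norm_real,
      Real.norm_eq_abs, abs_of_pos hr]
    exact mul_le_mul_of_nonneg_left h2.le hr.le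

theorem exists_near_right (h : γ.length < ENNReal.ofReal lam) {r : ℝ} {a : selfAdjoint X.carrier}
    (hr : 0 < r) (ha : X.L a ≤ ENNReal.ofReal r) : ∃ b, γ.Near lam r a b := by
  obtain ⟨a₀, ha₀, rfl⟩ := X.isQCMS.exists_smul_eq hr ha
  obtain ⟨_, ⟨b, hb, rfl⟩, hab⟩ := Metric.exists_edist_lt_of_hausdorffEDist_lt
    (Set.mem_image_of_mem _ (show a₀ ∈ X.lipBall from ha₀)) ((le_max_left _ _).trans_lt h)
  exact ⟨_, near_smul_of_edist_lt ha₀ hb hr hab⟩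

theorem exists_near_left (h : γ.length < ENNReal.ofReal lam) {r : ℝ} {b : selfAdjoint Y.carrier}
    (hr : 0 < r) (hb : Y.L b ≤ ENNReal.ofReal r) : ∃ a, γ.Near lam r a b := by
  obtain ⟨b₀, hb₀, rfl⟩ := Y.isQCMS.exists_smul_eq hr hb
  have h' : Metric.hausdorffEDist
      ((fun b : selfAdjoint Y.carrier => γ.pivot * γ.right b) '' Y.lipBall)
      ((fun a : selfAdjoint X.carrier => γ.left a * γ.pivot) '' X.lipBall) <
      ENNReal.ofReal lam := by
    rw [Metric.hausdorffEDist_comm]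
    exact (le_max_left _ _).trans_lt h
  obtain ⟨_, ⟨a, ha, rfl⟩, hab⟩ := Metric.exists_edist_lt_of_hausdorffEDist_lt
    (Set.mem_image_of_mem _ (show b₀ ∈ Y.lipBall from hb₀)) h'
  rw [edist_comm] at hab
  exact ⟨_, near_smul_of_edist_lt ha hb₀ hr hab⟩

theorem abs_re_sub_le {φ : State γ.D} (hφ : φ ∈ oneLevel γ.pivot) {a : selfAdjoint X.carrier}
    {b : selfAdjoint Y.carrier} {r : ℝ} (hab : γ.Near lam r a b) :
    |(φ.comp γ.left a).re - (φ.comp γ.right b).re| ≤ r * lam := by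
  rw [State.comp_apply, State.comp_apply, ← State.apply_mul_eq_of_mem_oneLevel hφ (γ.left a),
    ← State.apply_mul_eq_of_mem_oneLevel' hφ (γ.right b), ← Complex.sub_re, ← φ.map_sub]
  exact (Complex.abs_re_le_norm _).trans ((φ.norm_apply_le _).trans hab.2.2.2)

theorem exists_mem_oneLevel_right (h : γ.length < ENNReal.ofReal lam) (ψ : State Y.carrier) :
    ∃ φ ∈ oneLevel γ.pivot, mkEDist Y.L ψ (φ.comp γ.right) < ENNReal.ofReal lam := by
  obtain ⟨_, ⟨φ, hφ, rfl⟩, hd⟩ := @Metric.exists_edist_lt_of_hausdorffEDist_lt _ (mkSpace Y.L)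
    _ _ _ _ (Set.mem_univ ψ) (((le_max_right _ _).trans (le_max_right _ _)).trans_lt h)
  exact ⟨φ, hφ, hd⟩

theorem exists_mem_oneLevel_left (h : γ.length < ENNReal.ofReal lam) (ψ : State X.carrier) :
    ∃ φ ∈ oneLevel γ.pivot, mkEDist X.L ψ (φ.comp γ.left) < ENNReal.ofReal lam := by
  obtain ⟨_, ⟨φ, hφ, rfl⟩, hd⟩ := @Metric.exists_edist_lt_of_hausdorffEDist_lt _ (mkSpace X.L)
    _ _ _ _ (Set.mem_univ ψ) (((le_max_left _ _).trans (le_max_right _ _)).trans_lt h)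
  exact ⟨φ, hφ, hd⟩

/-- The pivot `ω` passes one factor at a time: `a a' ω - ω b b' = a (a' ω - ω b') + (a ω - ω b) b'`.
-/
theorem norm_mul_sub_mul_le {a a' : selfAdjoint X.carrier} {b b' : selfAdjoint Y.carrier}
    {r r' K : ℝ} (h0 : 0 ≤ lam) (hK : 0 < K) (ha : ‖a‖ ≤ K) (hb' : ‖b'‖ ≤ K)
    (h : γ.Near lam r a b) (h' : γ.Near lam r' a' b') :
    ‖γ.left ((a : X.carrier) * a') * γ.pivot - γ.pivot * γ.right ((b : Y.carrier) * b')‖ ≤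
      K * (r + r') * lam := by
  have e : γ.left ((a : X.carrier) * a') * γ.pivot - γ.pivot * γ.right ((b : Y.carrier) * b') =
      γ.left a * (γ.left a' * γ.pivot - γ.pivot * γ.right b') +
        (γ.left a * γ.pivot - γ.pivot * γ.right b) * γ.right b' := by
    rw [map_mul, map_mul]
    noncomm_ring
  have h1 : ‖γ.left a‖ ≤ K := (NonUnitalStarAlgHom.norm_apply_le γ.left _).trans ha
  have h2 : ‖γ.right b'‖ ≤ K := (NonUnitalStarAlgHom.norm_apply_le γ.right _).trans hb'
  have hr := h.1
  have hr' := h'.1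
  calc _ ≤ K * (r' * lam) + (r * lam) * K := by
        rw [e]
        refine (norm_add_le _ _).trans (add_le_add ((norm_mul_le _ _).trans ?_)
          ((norm_mul_le _ _).trans ?_))
        · exact mul_le_mul h1 h'.2.2.2 (norm_nonneg _) hK.le
        · exact mul_le_mul h.2.2.2 h2 (norm_nonneg _) (by positivity)
    _ = _ := by ring

theorem isApproxCorrespondence_near (hX : X.IsLeibniz) (hY : Y.IsLeibniz)
    (h : γ.length < ENNReal.ofReal lam) : IsApproxCorrespondence X Y lam (γ.Near lam) := by
  have h0 : 0 ≤ lam := (ENNReal.ofReal_pos.mp (zero_le.trans_lt h)).le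
  have hright : ∀ {r a b}, γ.Near lam r a b → ‖b‖ ≤ ‖a‖ + 2 * r * lam := fun {r a b} hab => by
    have hr := hab.1
    refine State.norm_selfAdjoint_le (by positivity) fun ψ => ?_
    -- The height replaces `ψ` by the restriction of a 1-level state, with error `r * lam` on `b`;
    -- that state then compares `b` with `a`, with a second error `r * lam`.
    obtain ⟨φ, hφ, hd⟩ := exists_mem_oneLevel_right h ψ
    have h1 := Y.isQCMS.abs_re_sub_le hr hab.2.2.1 h0 hd
    have h2 := abs_re_sub_le hφ hab
    have h3 := (φ.comp γ.left).abs_re_le a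
    rw [abs_le] at *
    constructor <;> linarith
  have hleft : ∀ {r a b}, γ.Near lam r a b → ‖a‖ ≤ ‖b‖ + 2 * r * lam := fun {r a b} hab => by
    have hr := hab.1
    refine State.norm_selfAdjoint_le (by positivity) fun ψ => ?_
    obtain ⟨φ, hφ, hd⟩ := exists_mem_oneLevel_left h ψ
    have h1 := X.isQCMS.abs_re_sub_le hr hab.2.1 h0 hd
    have h2 := abs_re_sub_le hφ hab
    have h3 := (φ.comp γ.right).abs_re_le b
    rw [abs_le] at *
    constructor <;> linarith
  refine ⟨h0, fun h => h.1, fun h => h.2.1, fun h => h.2.2.1, exists_near_right h,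
    exists_near_left h, ?_, ?_, ?_, hright, hleft, ?_, ?_⟩
  · intro r hr
    refine ⟨hr, X.isQCMS.map_one.trans_le zero_le, Y.isQCMS.map_one.trans_le zero_le, ?_⟩
    rw [selfAdjoint.val_one, selfAdjoint.val_one, map_one, map_one, one_mul, mul_one, sub_self,
      norm_zero]
    positivity
  · intro r r' a a' b b' h1 h2
    refine ⟨add_pos h1.1 h2.1, ?_, ?_, ?_⟩
    · rw [ENNReal.ofReal_add h1.1.le h2.1.le]
      exact (X.isQCMS.add_le _ _).trans (add_le_add h1.2.1 h2.2.1)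
    · rw [ENNReal.ofReal_add h1.1.le h2.1.le]
      exact (Y.isQCMS.add_le _ _).trans (add_le_add h1.2.2.1 h2.2.2.1)
    · rw [AddSubgroup.coe_add, AddSubgroup.coe_add, map_add, map_add, add_mul, mul_add,
        add_sub_add_comm, add_mul]
      exact (norm_add_le _ _).trans (add_le_add h1.2.2.2 h2.2.2.2)
  · intro r r' a b t h1 hr' ht
    refine ⟨hr', X.isQCMS.smul_le h1.2.1 ht, Y.isQCMS.smul_le h1.2.2.1 ht, ?_⟩
    rw [selfAdjoint.val_smul, selfAdjoint.val_smul, ← Complex.coe_smul, ← Complex.coe_smul,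
      map_smul, map_smul, smul_mul_assoc, mul_smul_comm, ← smul_sub, norm_smul, Complex.norm_real,
      Real.norm_eq_abs]
    calc _ ≤ |t| * (r * lam) := mul_le_mul_of_nonneg_left h1.2.2.2 (abs_nonneg t)
      _ = |t| * r * lam := by ring
      _ ≤ r' * lam := by gcongr
  · intro r r' a a' b b' K h1 h2 hK hr hr'
    have p1 := h1.1
    have p2 := h2.1
    have e1 : 0 ≤ r * lam := by positivity
    have e2 : 0 ≤ r' * lam := by positivity
    have na : ‖a‖ ≤ K := by linarith
    have na' : ‖a'‖ ≤ K := by linarith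
    have nb : ‖b‖ ≤ K := (hright h1).trans hr
    have nb' : ‖b'‖ ≤ K := (hright h2).trans hr'
    refine ⟨by positivity,
      (hX.leibniz.jordan_le _ _).trans (leibniz_bound p1 p2 hK h1.2.1 h2.2.1 na na'),
      (hY.leibniz.jordan_le _ _).trans (leibniz_bound p1 p2 hK h1.2.2.1 h2.2.2.1 nb nb'), ?_⟩
    -- The two orders of the product each contribute `K * (r + r') * lam`; the coefficient of norm
    -- `1 / 2` absorbs the doubling.
    have m1 := norm_mul_sub_mul_le h0 hK na nb' h1 h2
    have m2 := norm_mul_sub_mul_le h0 hK na' nb h2 h1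
    change ‖γ.left ((1 / 2 : ℂ) • ((a : X.carrier) * a' + a' * a)) * γ.pivot -
      γ.pivot * γ.right ((1 / 2 : ℂ) • ((b : Y.carrier) * b' + b' * b))‖ ≤ _
    rw [map_smul, map_smul, smul_mul_assoc, mul_smul_comm, ← smul_sub, norm_smul, map_add, map_add,
      add_mul, mul_add, add_sub_add_comm]
    have m3 := norm_add_le_of_le m1 m2
    have m4 : ‖(1 / 2 : ℂ)‖ = 1 / 2 := by simp
    rw [m4]
    linarith
  · intro r r' a a' b b' K h1 h2 hK hr hr'
    have p1 := h1.1
    have p2 := h2.1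
    have e1 : 0 ≤ r * lam := by positivity
    have e2 : 0 ≤ r' * lam := by positivity
    have na : ‖a‖ ≤ K := by linarith
    have na' : ‖a'‖ ≤ K := by linarith
    have nb : ‖b‖ ≤ K := (hright h1).trans hr
    have nb' : ‖b'‖ ≤ K := (hright h2).trans hr'
    refine ⟨by positivity,
      (hX.leibniz.lie_le _ _).trans (leibniz_bound p1 p2 hK h1.2.1 h2.2.1 na na'),
      (hY.leibniz.lie_le _ _).trans (leibniz_bound p1 p2 hK h1.2.2.1 h2.2.2.1 nb nb'), ?_⟩
    have m1 := norm_mul_sub_mul_le h0 hK na nb' h1 h2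
    have m2 := norm_mul_sub_mul_le h0 hK na' nb h2 h1
    change ‖γ.left ((1 / (2 * Complex.I) : ℂ) • ((a : X.carrier) * a' - a' * a)) * γ.pivot -
      γ.pivot * γ.right ((1 / (2 * Complex.I) : ℂ) • ((b : Y.carrier) * b' - b' * b))‖ ≤ _
    rw [map_smul, map_smul, smul_mul_assoc, mul_smul_comm, ← smul_sub, norm_smul, map_sub, map_sub,
      sub_mul, mul_sub, sub_sub_sub_comm]
    have m3 := norm_sub_le_of_le m1 m2
    have m4 : ‖(1 / (2 * Complex.I) : ℂ)‖ = 1 / 2 := by simp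
    rw [m4]
    linarith

end Bridge

theorem exists_real_add_eq_of_add_lt {x y : ℝ≥0∞} {lam : ℝ} (h : x + y < ENNReal.ofReal lam) :
    ∃ s t : ℝ, x < ENNReal.ofReal s ∧ y < ENNReal.ofReal t ∧ s + t = lam := by
  have hx : x ≠ ∞ := (lt_of_le_of_lt le_self_add (h.trans ENNReal.ofReal_lt_top)).ne
  have hy : y ≠ ∞ := (lt_of_le_of_lt le_add_self (h.trans ENNReal.ofReal_lt_top)).ne
  rw [← ENNReal.ofReal_toReal hx, ← ENNReal.ofReal_toReal hy,
    ← ENNReal.ofReal_add ENNReal.toReal_nonneg ENNReal.toReal_nonneg,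
    ENNReal.ofReal_lt_ofReal_iff_of_nonneg
      (add_nonneg ENNReal.toReal_nonneg ENNReal.toReal_nonneg)] at h
  refine ⟨x.toReal + (lam - x.toReal - y.toReal) / 2, y.toReal + (lam - x.toReal - y.toReal) / 2,
    ?_, ?_, by ring⟩
  · rw [← ENNReal.ofReal_toReal hx, ENNReal.ofReal_lt_ofReal_iff_of_nonneg ENNReal.toReal_nonneg,
      ENNReal.toReal_ofReal ENNReal.toReal_nonneg]
    linarith
  · rw [← ENNReal.ofReal_toReal hy, ENNReal.ofReal_lt_ofReal_iff_of_nonneg ENNReal.toReal_nonneg,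
      ENNReal.toReal_ofReal ENNReal.toReal_nonneg]
    linarith

theorem Trek.exists_isApproxCorrespondence {C : Set QuantumCompactMetricSpace.{u}}
    (hC : ∀ X ∈ C, X.IsLeibniz) {X Y : QuantumCompactMetricSpace.{u}} (Γ : Trek C X Y) :
    ∀ {lam : ℝ}, Γ.length < ENNReal.ofReal lam → ∃ T, IsApproxCorrespondence X Y lam T := by
  induction Γ with
  | single hX hY γ => exact fun h => ⟨_, γ.isApproxCorrespondence_near (hC _ hX) (hC _ hY) h⟩
  | cons hX γ Γ ih =>
    intro lam h
    obtain ⟨s, t, hs, ht, rfl⟩ := exists_real_add_eq_of_add_lt h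
    obtain ⟨T, hT⟩ := ih ht
    exact ⟨_, (γ.isApproxCorrespondence_near (hC _ hX) (hC _ Γ.left_mem) hs).comp hT⟩

/-! ### The limit relation along a free ultrafilter. -/

open Filter Topology

theorem continuous_jordan {A : Type u} [CStarAlgebra A] :
    Continuous fun p : selfAdjoint A × selfAdjoint A => jordan p.1 p.2 :=
  Continuous.subtype_mk (by fun_prop) _

theorem continuous_lie {A : Type u} [CStarAlgebra A] :
    Continuous fun p : selfAdjoint A × selfAdjoint A => lie p.1 p.2 :=
  Continuous.subtype_mk (by fun_prop) _

theorem exists_pos_le_ofReal {x : ℝ≥0∞} (hx : x < ∞) : ∃ r : ℝ, 0 < r ∧ x ≤ ENNReal.ofReal r :=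
  ⟨x.toReal + 1, by positivity, by
    rw [ENNReal.le_ofReal_iff_toReal_le hx.ne (by positivity)]
    linarith⟩

section Limit

variable {X Y : QuantumCompactMetricSpace.{u}}

/-- The pairs `(a, b)` such that `b` is a limit, along a fixed free ultrafilter, of elements that
the relations `T n` associate with `a` at the scale `r`. -/
def LimitRelation (T : ℕ → ℝ → selfAdjoint X.carrier → selfAdjoint Y.carrier → Prop) (r : ℝ)
    (a : selfAdjoint X.carrier) (b : selfAdjoint Y.carrier) : Prop :=
  ∃ β : ℕ → selfAdjoint Y.carrier, (∀ n, T n r a (β n)) ∧ Tendsto β (hyperfilter ℕ) (𝓝 b)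

theorem tendsto_mul_one_div_hyperfilter (c : ℝ) :
    Tendsto (fun n : ℕ => c * (1 / ((n : ℝ) + 1))) (hyperfilter ℕ) (𝓝 0) := by
  have h := (tendsto_one_div_add_atTop_nhds_zero_nat (𝕜 := ℝ)).const_mul c
  rw [mul_zero] at h
  exact h.mono_left Nat.hyperfilter_le_atTop

/-- One fixed ultrafilter makes all such sequences converge at once, so neither separability nor a
diagonal argument is needed. -/
theorem exists_tendsto_of_forall_le {A : Type u} [CStarAlgebra A] {L : selfAdjoint A → ℝ≥0∞}
    (hL : IsQuantumCompactMetric L) (hlsc : LowerSemicontinuous L) {r K : ℝ} (hr : 0 < r)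
    {β : ℕ → selfAdjoint A} (h : ∀ n, L (β n) ≤ ENNReal.ofReal r ∧ ‖β n‖ ≤ K) :
    ∃ b, L b ≤ ENNReal.ofReal r ∧ Tendsto β (hyperfilter ℕ) (𝓝 b) := by
  obtain ⟨b, hb, hb'⟩ := (hL.isCompact_setOf_le hlsc hr K).ultrafilter_le_nhds
    ((hyperfilter ℕ).map β)
      (le_principal_iff.mpr (Filter.univ_mem' (f := (hyperfilter ℕ : Filter ℕ)) h))
  exact ⟨b, hb.1, hb'⟩

variable {T : ℕ → ℝ → selfAdjoint X.carrier → selfAdjoint Y.carrier → Prop}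
  (hT : ∀ n : ℕ, IsApproxCorrespondence X Y (1 / ((n : ℝ) + 1)) (T n))
  (hX : X.IsLeibniz) (hY : Y.IsLeibniz)

theorem one_div_add_one_le_one (n : ℕ) : 1 / ((n : ℝ) + 1) ≤ 1 :=
  (div_le_one (by positivity)).mpr (by linarith [(Nat.cast_nonneg n : (0 : ℝ) ≤ n)])

theorem le_add_of_approx {x y r : ℝ} (hr : 0 < r) {n : ℕ}
    (h : x ≤ y + 2 * r * (1 / ((n : ℝ) + 1))) :
    x ≤ y + 2 * r := by
  have := mul_le_mul_of_nonneg_left (one_div_add_one_le_one n) (by positivity : 0 ≤ 2 * r)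
  linarith

namespace LimitRelation

include hT

theorem pos {r a b} (h : LimitRelation T r a b) : 0 < r :=
  let ⟨_, hβ, _⟩ := h
  (hT 0).pos (hβ 0)

theorem left_le {r a b} (h : LimitRelation T r a b) : X.L a ≤ ENNReal.ofReal r :=
  let ⟨_, hβ, _⟩ := h
  (hT 0).left_le (hβ 0)

theorem norm_eq {r a b} (h : LimitRelation T r a b) : ‖a‖ = ‖b‖ := by
  obtain ⟨β, hβ, hlim⟩ := h
  have h0 := tendsto_mul_one_div_hyperfilter (2 * r)
  refine le_antisymm ?_ ?_
  · have h1 := hlim.norm.add h0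
    rw [add_zero] at h1
    exact ge_of_tendsto' h1 fun n => (hT n).norm_left (hβ n)
  · have h1 := (tendsto_const_nhds (x := ‖a‖)).add h0
    rw [add_zero] at h1
    exact le_of_tendsto_of_tendsto' hlim.norm h1 fun n => (hT n).norm_right (hβ n)

theorem add {r r' a a' b b'} (h : LimitRelation T r a b) (h' : LimitRelation T r' a' b') :
    LimitRelation T (r + r') (a + a') (b + b') := by
  obtain ⟨β, hβ, hlim⟩ := h
  obtain ⟨β', hβ', hlim'⟩ := h'
  exact ⟨_, fun n => (hT n).add (hβ n) (hβ' n), hlim.add hlim'⟩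

theorem smul {r a b} (h : LimitRelation T r a b) (t : ℝ) :
    LimitRelation T (|t| * r + 1) (t • a) (t • b) := by
  have hr := h.pos hT
  obtain ⟨β, hβ, hlim⟩ := h
  exact ⟨_, fun n => (hT n).smul t (hβ n) (by positivity) (by linarith), hlim.const_smul t⟩

theorem one : LimitRelation T 1 1 1 :=
  ⟨fun _ => 1, fun n => (hT n).one one_pos, tendsto_const_nhds⟩

/-- The limit relation keeps one scale for all `n`, so products need a `K` that is uniform in `n`.
-/
theorem exists_scale {r r' a a' b b'} (h : LimitRelation T r a b) (h' : LimitRelation T r' a' b') :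
    ∃ K, 0 < K ∧ ∀ n : ℕ, ‖a‖ + 2 * r * (1 / ((n : ℝ) + 1)) ≤ K ∧
      ‖a'‖ + 2 * r' * (1 / ((n : ℝ) + 1)) ≤ K := by
  have hr := h.pos hT
  have hr' := h'.pos hT
  have n1 := norm_nonneg a
  have n2 := norm_nonneg a'
  refine ⟨‖a‖ + ‖a'‖ + 2 * r + 2 * r', by positivity, fun n => ⟨?_, ?_⟩⟩
  · linarith [le_add_of_approx hr (n := n) (le_refl (‖a‖ + 2 * r * (1 / ((n : ℝ) + 1))))]
  · linarith [le_add_of_approx hr' (n := n) (le_refl (‖a'‖ + 2 * r' * (1 / ((n : ℝ) + 1))))]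

theorem jordan {r r' a a' b b'} (h : LimitRelation T r a b) (h' : LimitRelation T r' a' b') :
    ∃ s, LimitRelation T s (jordan a a') (jordan b b') := by
  obtain ⟨K, hK, hn⟩ := exists_scale hT h h'
  obtain ⟨β, hβ, hlim⟩ := h
  obtain ⟨β', hβ', hlim'⟩ := h'
  exact ⟨_, _, fun n => (hT n).jordan (hβ n) (hβ' n) hK (hn n).1 (hn n).2,
    (continuous_jordan.tendsto (b, b')).comp (hlim.prodMk_nhds hlim')⟩

theorem lie {r r' a a' b b'} (h : LimitRelation T r a b) (h' : LimitRelation T r' a' b') :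
    ∃ s, LimitRelation T s (lie a a') (lie b b') := by
  obtain ⟨K, hK, hn⟩ := exists_scale hT h h'
  obtain ⟨β, hβ, hlim⟩ := h
  obtain ⟨β', hβ', hlim'⟩ := h'
  exact ⟨_, _, fun n => (hT n).lie (hβ n) (hβ' n) hK (hn n).1 (hn n).2,
    (continuous_lie.tendsto (b, b')).comp (hlim.prodMk_nhds hlim')⟩

include hY in
theorem exists_right {r a} (hr : 0 < r) (ha : X.L a ≤ ENNReal.ofReal r) :
    ∃ b, Y.L b ≤ ENNReal.ofReal r ∧ LimitRelation T r a b := by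
  choose β hβ using fun n => (hT n).exists_right hr ha
  obtain ⟨b, hb, hlim⟩ := exists_tendsto_of_forall_le Y.isQCMS hY.lsc hr
    (K := ‖a‖ + 2 * r) fun n => ⟨(hT n).right_le (hβ n),
      le_add_of_approx hr ((hT n).norm_right (hβ n))⟩
  exact ⟨b, hb, β, hβ, hlim⟩

include hX in
-- The definition favours sequences in `Y`, so the limit `a` of preimages `α n` of `b` needs new
-- partners `β n`. Differences are related at scale `r + r`, so `‖β n - b‖` is at most `‖a - α n‖`
-- plus a vanishing error.
theorem exists_left {r b} (hr : 0 < r) (hb : Y.L b ≤ ENNReal.ofReal r) :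
    ∃ a, LimitRelation T r a b := by
  choose α hα using fun n => (hT n).exists_left hr hb
  obtain ⟨a, ha, hlim⟩ := exists_tendsto_of_forall_le X.isQCMS hX.lsc hr
    (K := ‖b‖ + 2 * r) fun n => ⟨(hT n).left_le (hα n),
      le_add_of_approx hr ((hT n).norm_left (hα n))⟩
  choose β hβ using fun n => (hT n).exists_right hr ha
  refine ⟨a, β, hβ, ?_⟩
  rw [tendsto_iff_norm_sub_tendsto_zero] at hlim ⊢
  have h1 := hlim.add (tendsto_mul_one_div_hyperfilter (2 * (r + r)))
  rw [add_zero] at h1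
  refine squeeze_zero (fun n => norm_nonneg _) (fun n => ?_) h1
  have h2 := (hT n).norm_right ((hT n).sub (hβ n) (hα n))
  rwa [norm_sub_rev a] at h2

end LimitRelation

include hT hX hY in
theorem isLieJordanRelation_limitRelation :
    IsLieJordanRelation fun a b => ∃ r, LimitRelation T r a b where
  add := fun ⟨_, h⟩ ⟨_, h'⟩ => ⟨_, h.add hT h'⟩
  smul := fun t _ _ ⟨_, h⟩ => ⟨_, h.smul hT t⟩
  one := ⟨1, LimitRelation.one hT⟩
  jordan := fun ⟨_, h⟩ ⟨_, h'⟩ => h.jordan hT h'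
  lie := fun ⟨_, h⟩ ⟨_, h'⟩ => h.lie hT h'
  norm_eq := fun ⟨_, h⟩ => h.norm_eq hT
  dense_left := by
    refine X.isQCMS.dense_dom.mono fun a ha => ?_
    obtain ⟨r, hr, hle⟩ := exists_pos_le_ofReal ha
    obtain ⟨b, -, hb⟩ := LimitRelation.exists_right hT hY hr hle
    exact ⟨b, r, hb⟩
  dense_right := by
    refine Y.isQCMS.dense_dom.mono fun b hb => ?_
    obtain ⟨r, hr, hle⟩ := exists_pos_le_ofReal hb
    obtain ⟨a, ha⟩ := LimitRelation.exists_left hT hX hr hle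
    exact ⟨a, r, ha⟩

include hT hX hY in
-- `Φ` extends the limit relation and is injective, so the partner of `a` or of `Φ a` found at scale
-- `r` must be `Φ a` or `a` itself; thus `Φ` matches the balls of every positive radius.
theorem exists_intertwines_of_approx : ∃ Φ : X.carrier ≃⋆ₐ[ℂ] Y.carrier, Intertwines X Y Φ := by
  obtain ⟨Φ, hΦ⟩ := (isLieJordanRelation_limitRelation hT hX hY).exists_starAlgEquiv
  refine ⟨Φ, fun a => ?_⟩
  have key : ∀ r : ℝ, 0 < r →
      (Y.L (saMap Φ a) ≤ ENNReal.ofReal r ↔ X.L a ≤ ENNReal.ofReal r) := fun r hr => by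
    constructor
    · intro h
      obtain ⟨a', ha'⟩ := LimitRelation.exists_left hT hX hr h
      have h1 : Φ a' = Φ a := hΦ _ _ ⟨r, ha'⟩
      have h2 : a' = a := Subtype.ext (Φ.injective h1)
      exact h2 ▸ ha'.left_le hT
    · intro h
      obtain ⟨b, hb, hab⟩ := LimitRelation.exists_right hT hY hr h
      have h1 : saMap Φ a = b := Subtype.ext (hΦ _ _ ⟨r, hab⟩)
      exact h1 ▸ hb
  have hle : ∀ x y : ℝ≥0∞,
      (∀ r : ℝ, 0 < r → y ≤ ENNReal.ofReal r → x ≤ ENNReal.ofReal r) → x ≤ y := fun x y h => by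
    refine le_of_forall_gt_imp_ge_of_dense fun c hc => ?_
    rcases eq_or_ne c ∞ with rfl | hc'
    · exact le_top
    rw [← ENNReal.ofReal_toReal hc'] at hc ⊢
    exact h _ (ENNReal.ofReal_pos.mp (zero_le.trans_lt hc)) hc.le
  exact le_antisymm (hle _ _ fun r hr => (key r hr).mpr) (hle _ _ fun r hr => (key r hr).mp)

end Limit

/-! ### Distance zero, and assembly of the theorem. -/

theorem exists_intertwines_of_propinquity_eq_zero {C : Set QuantumCompactMetricSpace.{u}}
    (hC : ∀ X ∈ C, X.IsLeibniz) {X Y : QuantumCompactMetricSpace.{u}} (hX : X ∈ C) (hY : Y ∈ C)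
    (h : propinquity C X Y = 0) : ∃ Φ : X.carrier ≃⋆ₐ[ℂ] Y.carrier, Intertwines X Y Φ := by
  have hn : ∀ n : ℕ, ∃ T, IsApproxCorrespondence X Y (1 / ((n : ℝ) + 1)) T := fun n => by
    have hpos : propinquity C X Y < ENNReal.ofReal (1 / ((n : ℝ) + 1)) := by
      rw [h, ENNReal.ofReal_pos]
      positivity
    obtain ⟨Γ, hΓ⟩ := iInf_lt_iff.mp hpos
    exact Γ.exists_isApproxCorrespondence hC hΓ
  choose T hT using hn
  exact exists_intertwines_of_approx hT (hC X hX) (hC Y hY)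

end Propinquity

theorem mainTheorem2 (C : Set Propinquity.QuantumCompactMetricSpace.{u}) (_hne : C.Nonempty)
    (hC : ∀ X ∈ C, X.IsLeibniz) :
    (∀ X ∈ C, ∀ Y ∈ C,
      Propinquity.propinquity C X Y < ∞ ∧
      Propinquity.propinquity C X Y ≤ max X.stateDiam Y.stateDiam) ∧
    (∀ X ∈ C, ∀ Y ∈ C, Propinquity.propinquity C X Y = Propinquity.propinquity C Y X) ∧
    (∀ X ∈ C, ∀ Y ∈ C, ∀ Z ∈ C,
      Propinquity.propinquity C X Y ≤
        Propinquity.propinquity C X Z + Propinquity.propinquity C Z Y) ∧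
    (∀ X ∈ C, ∀ Y ∈ C,
      (Propinquity.propinquity C X Y = 0 ↔
        ∃ Φ : X.carrier ≃⋆ₐ[ℂ] Y.carrier,
          Propinquity.QuantumCompactMetricSpace.IsIsometricIso X Y Φ) ∧
      (Propinquity.propinquity C X Y = 0 ↔
        ∃ Φ : X.carrier ≃⋆ₐ[ℂ] Y.carrier,
          Propinquity.QuantumCompactMetricSpace.Intertwines X Y Φ)) := by
  have hzero : ∀ X ∈ C, ∀ Y ∈ C, (Propinquity.propinquity C X Y = 0 ↔
      ∃ Φ : X.carrier ≃⋆ₐ[ℂ] Y.carrier,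
        Propinquity.QuantumCompactMetricSpace.Intertwines X Y Φ) := fun X hX Y hY =>
    ⟨Propinquity.exists_intertwines_of_propinquity_eq_zero hC hX hY,
      fun ⟨_, h⟩ => Propinquity.propinquity_eq_zero_of_intertwines hX hY h⟩
  refine ⟨fun X hX Y hY => ?_, fun X _ Y _ => Propinquity.propinquity_comm,
    fun X _ Y _ Z _ => Propinquity.propinquity_triangle, fun X hX Y hY => ⟨?_, hzero X hX Y hY⟩⟩
  · obtain ⟨D, _, f, g, hf, hg⟩ := Propinquity.exists_common_embedding X.carrier Y.carrier
    have h := Propinquity.propinquity_le_max_stateDiam hX hY hf hg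
    exact ⟨h.trans_lt (max_lt X.stateDiam_lt_top Y.stateDiam_lt_top), h⟩
  · rw [hzero X hX Y hY]
    exact exists_congr fun Φ => ⟨fun h => h.isIsometricIso,
      fun h => h.intertwines (hC X hX) (hC Y hY)⟩
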